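/- Let $\mathbb C_{\rm cut}=\mathbb C\setminus((-\infty,0]\cup[1,\infty))$ and let $\overline{\mathbb C}_{\rm cut}$ be obtained from it by adding two boundary points $x\pm 0i=\lim_{t\searrow0}(x\pm ti)$ for each $x\in(-\infty,0)\cup(1,\infty)$. The principal branches of $\operatorname{Log} z$, $\operatorname{Log}(1-z)$ and $\operatorname{Li}_2(z)$ are extended to $\overline{\mathbb C}_{\rm cut}$ by continuity. Let $\widehat{\mathbb C}$ be the quotient of $\overline{\mathbb C}_{\rm cut}\times(2\mathbb Z)^2$ by the identifications $(x+0i;2p,2q)\sim(x-0i;2p+2,2q)$ for $x<0$ and $(x+0i;2p,2q)\sim(x-0i;2p,2q+2)$ for $x>1$; this is the universal abelian cover $\widehat\pi\colon\widehat{\mathbb C}\to\mathbb C\setminus\{0,1\}$. Let $$\mathrm{FT}=\Bigl\{\Bigl(x,y,\tfrac yx,\tfrac{1-1/x}{1-1/y},\tfrac{1-x}{1-y}\Bigr)\Bigm| x\neq y\in\mathbb C\setminus\{0,1\}\Bigr\},$$ and let $\widehat{\mathrm{FT}}$ be the connected component of the preimage of $\mathrm{FT}$ in $\widehat{\mathbb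 C}^5$ that contains all points $((z_0;0,0),\dots,(z_4;0,0))$ with $(z_0,\dots,z_4)\in\mathrm{FT}$ and $\operatorname{Im}z_0,\dots,\operatorname{Im}z_4>0$. The extended pre-Bloch group $\widehat{\mathcal P}(\mathbb C)$ is the quotient of the free abelian group $\mathbb Z[\widehat{\mathbb C}]$ by the subgroup generated by all $[\widehat z_0]-[\widehat z_1]+[\widehat z_2]-[\widehat z_3]+[\widehat z_4]$ with $(\widehat z_0,\dots,\widehat z_4)\in\widehat{\mathrm{FT}}$. Write $[z;2p,2q]$ for the class of $(z;2p,2q)$ in $\widehat{\mathcal P}(\mathbb C)$, and put $\mathbb Z(2)=(2\pi i)^2\mathbb Z$. For $z\in\overline{\mathbb C}_{\rm cut}$ and $p\in\mathbb Z$, the element $$\{z;2p\}=[z;2p,2q]-[z;2p,2(q-1)]\in\widehat{\mathcal P}(\mathbb C)$$ is independent of $q\in\mathbb Z$. The element $$\widehat\kappa=\{z;2p\}-\{z;2(p-1)\}\in\widehat{\mathcal P}(\mathbb C)$$ is independent of $z\in\overline{\mathbb C}_{\rm cut}$ (in particular of $z\in\mathbb C\setminus\{0,1\}$, where a real $z\in(-\infty,0)\cup(1,\infty)$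 is read as $z+0i$) and of $p\in\mathbb Z$, and it has order exactly $2$. Moreover, there is a (unique) homomorphism $\widehat L\colon\widehat{\mathcal P}(\mathbb C)\to\mathbb C/\mathbb Z(2)$ such that, for all $z\in\overline{\mathbb C}_{\rm cut}$ and $p,q\in\mathbb Z$, $$\widehat L([z;2p,2q])=\operatorname{Li}_2(z)+\tfrac12\bigl(\operatorname{Log}z+2\pi i\,p\bigr)\bigl(\operatorname{Log}(1-z)+2\pi i\,q\bigr)-\tfrac{\pi^2}6 \mod \mathbb Z(2),$$ and it satisfies $\widehat L(\widehat\kappa)=-2\pi^2\neq0$ in $\mathbb C/\mathbb Z(2)$. -/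

import Mathlib

noncomputable section

namespace ExtBloch

/-- The cut plane `ℂ_cut = ℂ ∖ ((-∞,0] ∪ [1,∞))`. -/
def cutDomain : Set ℂ :=
  {z | ¬ (z.im = 0 ∧ (z.re ≤ 0 ∨ 1 ≤ z.re))}

/-- The completed cut plane: `ℂ_cut` together with two boundary points `x + 0i` (`above x`) and
`x - 0i` (`below x`) for every real `x` in `(-∞,0) ∪ (1,∞)`. -/
inductive CutPlane : Type
  | inner (z : ℂ) (hz : z ∈ cutDomain) : CutPlane
  | above (x : ℝ) (hx : x < 0 ∨ 1 < x) : CutPlane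
  | below (x : ℝ) (hx : x < 0 ∨ 1 < x) : CutPlane

namespace CutPlane

/-- The underlying complex number. -/
def toComplex : CutPlane → ℂ
  | inner z _ => z
  | above x _ => (x : ℂ)
  | below x _ => (x : ℂ)

/-- The principal branch of `Log z`, extended by its limits to the points `x ± 0i`. For `x < 0`,
Mathlib's `Complex.log x` has imaginary part `π`, so it is the limit from above and its conjugate is
the limit from below; for `x > 1` it is real and both agree. -/
def log : CutPlane → ℂ
  | inner z _ => Complex.log z
  | above x _ => Complex.log (x : ℂ)
  | below x _ => (starRingEnd ℂ) (Complex.log (x : ℂ))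

/-- The function `Log (1 - z)` (principal branch), extended by its limits to the points `x ± 0i`.
If `z` tends to `x > 1` from above then `1 - z` tends to `1 - x < 0` from below. -/
def logOneSub : CutPlane → ℂ
  | inner z _ => Complex.log (1 - z)
  | above x _ => (starRingEnd ℂ) (Complex.log (1 - (x : ℂ)))
  | below x _ => Complex.log (1 - (x : ℂ))

/-- The integral `-∫₀ᶻ log (1 - t) dt / t` along the straight segment `t = s z`, `0 ≤ s ≤ 1`. For `z`
outside `[1,∞)` this is the principal branch of the dilogarithm. For real `z = x > 1` the integrand
uses the value of `log` on the negative axis with imaginary part `+π`, so that this is the limit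
of the principal branch at `x - 0i`. -/
def dilogIntegral (z : ℂ) : ℂ :=
  -∫ s in (0 : ℝ)..1, Complex.log (1 - (s : ℂ) * z) / (s : ℂ)

/-- The principal branch of the dilogarithm `Li₂`, extended by its limits to the points `x ± 0i`
(the values at `x + 0i` and `x - 0i` are complex conjugate to each other). -/
def dilog : CutPlane → ℂ
  | inner z _ => dilogIntegral z
  | above x _ => (starRingEnd ℂ) (dilogIntegral (x : ℂ))
  | below x _ => dilogIntegral (x : ℂ)

/-- The topology of the completed cut plane, given as the coarsest one for which the extended
functions `Log z` and `Log (1 - z)` are continuous. On `ℂ_cut` it is the usual topology, and the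
neighbourhoods of `x + 0i` (of `x - 0i`) are the half discs around `x` in the closed upper (lower)
half plane, their diameter consisting of the points `x' + 0i` (`x' - 0i`). -/
instance : TopologicalSpace CutPlane :=
  TopologicalSpace.induced (fun z : CutPlane => (z.log, z.logOneSub)) inferInstance

end CutPlane

/-- The identifications `(x + 0i, 2p, 2q) ∼ (x - 0i, 2p + 2, 2q)` for `x < 0` and
`(x + 0i, 2p, 2q) ∼ (x - 0i, 2p, 2q + 2)` for `x > 1`. A pair `(p, q) : ℤ × ℤ` stands for the element
`(2p, 2q)` of `(2ℤ)²`. -/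
inductive ChatRel : CutPlane × ℤ × ℤ → CutPlane × ℤ × ℤ → Prop
  | neg (x : ℝ) (hx : x < 0) (p q : ℤ) :
      ChatRel (CutPlane.above x (Or.inl hx), p, q) (CutPlane.below x (Or.inl hx), p + 1, q)
  | gtOne (x : ℝ) (hx : 1 < x) (p q : ℤ) :
      ChatRel (CutPlane.above x (Or.inr hx), p, q) (CutPlane.below x (Or.inr hx), p, q + 1)

/-- The universal abelian cover `Ĉ` of `ℂ ∖ {0,1}`: the quotient of (completed cut plane) `× (2ℤ)²`
by the equivalence relation generated by `ChatRel`. -/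
def Chat : Type := Quot ChatRel

/-- `Ĉ` carries the quotient topology (`ℤ` being discrete). -/
instance : TopologicalSpace Chat := inferInstanceAs (TopologicalSpace (Quot ChatRel))

/-- The point `(z; 2p, 2q)` of `Ĉ`. -/
def Chat.mk (z : CutPlane) (p q : ℤ) : Chat := Quot.mk ChatRel (z, p, q)

/-- The covering projection from `Ĉ` to `ℂ ∖ {0,1}`, as a map to `ℂ`. -/
def Chat.proj : Chat → ℂ :=
  Quot.lift (fun a : CutPlane × ℤ × ℤ => a.1.toComplex) (by
    intro a b h
    cases h <;> rfl)

/-- The set of five term relations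
`(x, y, y/x, (1 - 1/x)/(1 - 1/y), (1 - x)/(1 - y))`, `x ≠ y` in `ℂ ∖ {0,1}`. -/
def FT : Set (Fin 5 → ℂ) :=
  {z | ∃ x y : ℂ, x ≠ 0 ∧ x ≠ 1 ∧ y ≠ 0 ∧ y ≠ 1 ∧ x ≠ y ∧
    z = ![x, y, y / x, (1 - 1 / x) / (1 - 1 / y), (1 - x) / (1 - y)]}

/-- The preimage of `FT` in `Ĉ⁵`. -/
def FTpre : Set (Fin 5 → Chat) :=
  {w | (fun i => (w i).proj) ∈ FT}

/-- The set of all `((z₀;0,0), …, (z₄;0,0))` with `(z₀, …, z₄) ∈ FT` and all `Im zᵢ > 0`. -/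
def FThatPlus : Set (Fin 5 → Chat) :=
  {w | ∃ z ∈ FT, ∀ i, 0 < (z i).im ∧
    ∃ h : z i ∈ cutDomain, w i = Chat.mk (CutPlane.inner (z i) h) 0 0}

/-- The connected component of the preimage of `FT` in `Ĉ⁵` that contains the (connected) set
`FThatPlus`. -/
def FThat : Set (Fin 5 → Chat) :=
  {w | ∃ w₀ ∈ FThatPlus, w ∈ connectedComponentIn FTpre w₀}

/-- The homomorphism `ρ̂ : ℤ[F̂T] → ℤ[Ĉ]`,
`[z₀, …, z₄] ↦ [z₀] - [z₁] + [z₂] - [z₃] + [z₄]`. -/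
def rhohat : FreeAbelianGroup FThat →+ FreeAbelianGroup Chat :=
  FreeAbelianGroup.lift (fun w : FThat =>
    FreeAbelianGroup.of (w.1 0) - FreeAbelianGroup.of (w.1 1) + FreeAbelianGroup.of (w.1 2)
      - FreeAbelianGroup.of (w.1 3) + FreeAbelianGroup.of (w.1 4))

/-- The extended pre-Bloch group `P̂(ℂ) = ℤ[Ĉ] / im ρ̂`. -/
abbrev PreBloch : Type := FreeAbelianGroup Chat ⧸ rhohat.range

/-- The class `[z; 2p, 2q]` in the extended pre-Bloch group. -/
def sym (z : CutPlane) (p q : ℤ) : PreBloch :=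
  QuotientAddGroup.mk (FreeAbelianGroup.of (Chat.mk z p q))

/-- The element `[z; 2p, 2q] - [z; 2p, 2(q - 1)]`, which is `{z; 2p}` computed with a given `q`. -/
def brace (z : CutPlane) (p q : ℤ) : PreBloch := sym z p q - sym z p (q - 1)

/-- The function
`L(z; 2p, 2q) = Li₂(z) + ½ (Log z + 2πi p) (Log (1 - z) + 2πi q) - π²/6`. -/
def rogers (z : CutPlane) (p q : ℤ) : ℂ :=
  z.dilog
    + 1 / 2 * (z.log + 2 * (Real.pi : ℂ) * Complex.I * (p : ℂ))
        * (z.logOneSub + 2 * (Real.pi : ℂ) * Complex.I * (q : ℂ))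
    - (Real.pi : ℂ) ^ 2 / 6

/-- The subgroup `ℤ(2) = (2πi)² ℤ` of `ℂ`. -/
def Z2 : AddSubgroup ℂ := AddSubgroup.zmultiples ((2 * (Real.pi : ℂ) * Complex.I) ^ 2)

end ExtBloch

end

noncomputable section

set_option autoImplicit false

namespace ExtBloch

open CutPlane (dilogIntegral)
open Complex Filter Topology MeasureTheory Set

/-! ### The dilogarithm -/

/-! The cover is the curve `e ^ u + e ^ v = 1` in disguise: `(z; 2p, 2q)` corresponds to `u = Log z
+ 2πi p`, `v = Log (1 - z) - 2πi q`, where the minus sign is forced by the identification over `x >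
1`. In these coordinates both assertions become statements about logarithms.

The component of the five term relations is parametrized by independent choices `a, b, c, d, e` of
logarithms of `x, 1 - x, y, 1 - y, x - y` (`FThat_eq_image`). One inclusion holds because the linear
relations between the five pairs of logarithms can only fail by multiples of `2πi`, hence are
locally constant, and they hold at the base points. The other holds because the space of all such
choices of logarithms is path connected (`isPathConnected_logCover`): a small loop around one
hyperplane of the arrangement changes just one logarithm by `2πi`.

So any of the five logarithms may be shifted by `2πi` in a relation, and relations may be
subtracted. Shifting `e` gives a three term relation between differences `{z; 2p}`. Shifting `a, c,
e` in it together shows that these depend on `u` only (`logBrace_add_tau_right`); they form a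
function `chi u`, and the three term relation says that `chi` is additive away from `e ^ u = 1`
(`chi_add`). Hence `κ̂ = chi u - chi (u - 2πi)` does not depend on `u`. Shifting `a, c, e` in the
five term relation itself, for two values of `b` that differ by `2πi`, gives `2 κ̂ = 0`
(`two_nsmul_kappa`).

That `κ̂ ≠ 0` is seen by the Rogers dilogarithm, a primitive of `(u dv - v du) / 2`, well defined
modulo `ℤ(2)` by the reflection formula for `Li₂`. Its alternating sum over a five term relation has
zero differential, so it is constant on the connected parameter space, and it vanishes by a real
degeneration `y → x` (`fiveSum_eq_zero`). On `κ̂` it takes the value `(2πi)² / 2`, which is not in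
`ℤ(2)`. -/

theorem isOpen_one_sub_slitPlane : IsOpen {z : ℂ | 1 - z ∈ slitPlane} :=
  isOpen_slitPlane.preimage (by fun_prop)

theorem hasDerivAt_log_one_sub {z : ℂ} (hz : 1 - z ∈ slitPlane) :
    HasDerivAt (fun w : ℂ => log (1 - w)) (-1 / (1 - z)) z := by
  simpa using ((hasDerivAt_const z (1 : ℂ)).sub (hasDerivAt_id z)).clog hz

theorem one_sub_smul_mem_slitPlane {z : ℂ} (hz : 1 - z ∈ slitPlane) {s : ℝ} (h0 : 0 ≤ s)
    (h1 : s ≤ 1) : 1 - (s : ℂ) * z ∈ slitPlane := by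
  rw [mem_slitPlane_iff] at hz ⊢
  simp only [sub_re, one_re, sub_im, one_im, zero_sub, ne_eq, neg_eq_zero, re_ofReal_mul,
    im_ofReal_mul, mul_eq_zero, not_or] at hz ⊢
  rcases eq_or_lt_of_le h0 with rfl | h0
  · left; simp
  rcases hz with hz | hz
  · left; nlinarith
  · exact Or.inr ⟨h0.ne', hz⟩

/-- The holomorphic function `log (1 - z) / z`, with its removable singularity at `0` removed. -/
def logKernel : ℂ → ℂ := dslope (fun w : ℂ => log (1 - w)) 0

theorem logKernel_of_ne {z : ℂ} (hz : z ≠ 0) : logKernel z = log (1 - z) / z := by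
  rw [logKernel, dslope_of_ne _ hz, slope_def_field]
  simp

theorem continuousOn_logKernel : ContinuousOn logKernel {z : ℂ | 1 - z ∈ slitPlane} := by
  have h0 : (1 : ℂ) - 0 ∈ slitPlane := by simp
  rw [logKernel, continuousOn_dslope (isOpen_one_sub_slitPlane.mem_nhds h0)]
  exact ⟨fun z hz => (hasDerivAt_log_one_sub hz).continuousAt.continuousWithinAt,
    (hasDerivAt_log_one_sub h0).differentiableAt⟩

theorem log_one_sub_mul_div (z : ℂ) {s : ℝ} (hs : s ≠ 0) :
    log (1 - (s : ℂ) * z) / (s : ℂ) = z * logKernel (s * z) := by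
  have hs' : (s : ℂ) ≠ 0 := by exact_mod_cast hs
  by_cases hz : z = 0
  · simp [hz]
  rw [logKernel_of_ne (mul_ne_zero hs' hz)]
  field_simp

theorem intervalIntegrable_log_one_sub_mul_div {z : ℂ} (hz : 1 - z ∈ slitPlane) :
    IntervalIntegrable (fun s : ℝ => log (1 - (s : ℂ) * z) / (s : ℂ)) volume 0 1 := by
  have h : ContinuousOn (fun s : ℝ => z * logKernel (s * z)) (uIcc 0 1) := by
    refine continuousOn_const.mul (continuousOn_logKernel.comp (by fun_prop) fun s hs => ?_)
    rw [uIcc_of_le zero_le_one] at hs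
    exact one_sub_smul_mem_slitPlane hz hs.1 hs.2
  refine (h.intervalIntegrable).congr ?_
  intro s hs
  rw [uIoc_of_le zero_le_one] at hs
  exact (log_one_sub_mul_div z hs.1.ne').symm

/-- Differentiation under the integral sign: the `w`-derivative of the integrand is `-1 / (1 - s
w)`, bounded near `z` uniformly in `s`, and its integral over `s` is elementary. -/
theorem hasDerivAt_dilogIntegral {z : ℂ} (hz : 1 - z ∈ slitPlane) (hz0 : z ≠ 0) :
    HasDerivAt dilogIntegral (-log (1 - z) / z) z := by
  obtain ⟨ε, hε, hball⟩ := Metric.isOpen_iff.1 isOpen_one_sub_slitPlane z hz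
  have hball' : Metric.closedBall z (ε / 2) ⊆ {w : ℂ | 1 - w ∈ slitPlane} :=
    (Metric.closedBall_subset_ball (by linarith)).trans hball
  have hcont : ContinuousOn (fun x : ℝ × ℂ => -1 / (1 - (x.1 : ℂ) * x.2))
      (Icc (0 : ℝ) 1 ×ˢ Metric.closedBall z (ε / 2)) := by
    refine ContinuousOn.div continuousOn_const (by fun_prop) fun x hx => ?_
    exact slitPlane_ne_zero (one_sub_smul_mem_slitPlane (hball' hx.2) hx.1.1 hx.1.2)
  obtain ⟨C, hC⟩ := (isCompact_Icc.prod (isCompact_closedBall z (ε / 2))).exists_bound_of_continuousOn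
    hcont
  have key := intervalIntegral.hasDerivAt_integral_of_dominated_loc_of_deriv_le
    (μ := volume) (a := 0) (b := 1) (bound := fun _ => C) (x₀ := z) (s := Metric.closedBall z (ε / 2))
    (F := fun (w : ℂ) (s : ℝ) => log (1 - (s : ℂ) * w) / (s : ℂ))
    (F' := fun (w : ℂ) (s : ℝ) => -1 / (1 - (s : ℂ) * w))
    (Metric.closedBall_mem_nhds z (by linarith))
    (Eventually.of_forall fun w => (by fun_prop : Measurable _).aestronglyMeasurable)
    (intervalIntegrable_log_one_sub_mul_div hz)
    (by fun_prop : Measurable _).aestronglyMeasurable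
    (Eventually.of_forall fun t ht w hw => by
      rw [uIoc_of_le zero_le_one] at ht
      exact hC (t, w) ⟨⟨ht.1.le, ht.2⟩, hw⟩)
    intervalIntegrable_const
    (Eventually.of_forall fun t ht w hw => by
      rw [uIoc_of_le zero_le_one] at ht
      have ht0 : (t : ℂ) ≠ 0 := by exact_mod_cast ht.1.ne'
      have hs := one_sub_smul_mem_slitPlane (hball' hw) ht.1.le ht.2
      have h1 : HasDerivAt (fun w : ℂ => 1 - (t : ℂ) * w) (-(t : ℂ)) w := by
        simpa using ((hasDerivAt_id w).const_mul (t : ℂ)).const_sub 1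
      exact ((h1.clog hs).div_const (t : ℂ)).congr_deriv (by field_simp))
  have hint : ∫ s in (0 : ℝ)..1, -1 / (1 - (s : ℂ) * z) = log (1 - z) / z := by
    have : ∀ s ∈ uIcc (0 : ℝ) 1,
        HasDerivAt (fun s : ℝ => log (1 - (s : ℂ) * z) / z) (-1 / (1 - (s : ℂ) * z)) s := by
      intro s hs
      rw [uIcc_of_le zero_le_one] at hs
      have hs := one_sub_smul_mem_slitPlane hz hs.1 hs.2
      have h1 : HasDerivAt (fun s : ℝ => 1 - (s : ℂ) * z) (-z) s := by
        simpa using ((ofRealCLM.hasDerivAt (x := s)).mul_const z).const_sub 1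
      exact ((h1.clog_real hs).div_const z).congr_deriv (by field_simp)
    rw [intervalIntegral.integral_eq_sub_of_hasDerivAt this key.1]
    simp
  have := key.2.neg
  rw [hint] at this
  exact this.congr_deriv (by ring)

/-- The integrand `log (1 - t) / t` of the dilogarithm on the real line. -/
def realKernel (t : ℝ) : ℂ := log (1 - (t : ℂ)) / t

theorem dilogIntegral_ofReal (x : ℝ) : dilogIntegral x = -∫ t in (0 : ℝ)..x, realKernel t := by
  rcases eq_or_ne x 0 with rfl | hx
  · simp [dilogIntegral]
  have hx' : (x : ℂ) ≠ 0 := by exact_mod_cast hx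
  have h := intervalIntegral.integral_comp_mul_right (a := 0) (b := 1) realKernel hx
  have h2 : ∫ s in (0 : ℝ)..1, log (1 - (s : ℂ) * x) / (s : ℂ) =
      ∫ s in (0 : ℝ)..1, (x : ℂ) * realKernel (s * x) := by
    refine intervalIntegral.integral_congr fun s _ => ?_
    rcases eq_or_ne s 0 with rfl | hs
    · simp [realKernel]
    have hs' : (s : ℂ) ≠ 0 := by exact_mod_cast hs
    simp only [realKernel, ofReal_mul]
    field_simp
  rw [dilogIntegral, h2, intervalIntegral.integral_const_mul, h]
  simp [hx']

theorem log_one_sub_ofReal (t : ℝ) :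
    log (1 - (t : ℂ)) = (Real.log (1 - t) : ℂ) + (if 1 < t then (Real.pi : ℂ) * I else 0) := by
  split_ifs with h
  · have h2 : (1 : ℂ) - t = ((1 - t : ℝ) : ℂ) := by push_cast; ring
    rw [h2, Complex.log, arg_ofReal_of_neg (by linarith), norm_real, Real.norm_eq_abs, Real.log_abs]
  · have h1 : (1 : ℂ) - t = ((1 - t : ℝ) : ℂ) := by push_cast; ring
    rw [h1, ← ofReal_log (by linarith)]; simp

/-- To the left of `1 / 2` the only singularity is the removable one at `0`; to the right there are
an integrable logarithm and a jump by `πi` at `1`. -/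
theorem intervalIntegrable_realKernel (a b : ℝ) : IntervalIntegrable realKernel volume a b := by
  set M : ℝ := |a| + |b| + 1
  have hM : 1 ≤ M := by simp only [M]; linarith [abs_nonneg a, abs_nonneg b]
  have hleft : IntervalIntegrable realKernel volume (-M) (1 / 2) := by
    have h : ContinuousOn (fun t : ℝ => logKernel t) (uIcc (-M) (1 / 2)) := by
      refine continuousOn_logKernel.comp (by fun_prop) fun t ht => ?_
      rw [uIcc_of_le (by linarith)] at ht
      simp only [mem_ofPred_eq, mem_slitPlane_iff]
      left
      simp only [sub_re, one_re, ofReal_re]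
      linarith [ht.2]
    refine h.intervalIntegrable.congr_ae (ae_restrict_of_ae ?_)
    filter_upwards [compl_mem_ae_iff.2 (measure_singleton (0 : ℝ))] with t ht
    exact logKernel_of_ne (by exact_mod_cast ht)
  have hright : IntervalIntegrable realKernel volume (1 / 2) M := by
    have h1 : IntervalIntegrable (fun t : ℝ => (Real.log (1 - t) : ℂ)) volume (1 / 2) M := by
      have := (intervalIntegral.intervalIntegrable_log' (a := 1 / 2) (b := 1 - M)).comp_sub_left 1
      norm_num at this
      rw [intervalIntegrable_iff] at this ⊢
      exact this.ofReal
    have h2 : IntervalIntegrable (fun t : ℝ => if 1 < t then (Real.pi : ℂ) * I else 0) volume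
        (1 / 2) M := by
      rw [intervalIntegrable_iff]
      exact Measure.integrableOn_of_bounded (M := ‖(Real.pi : ℂ) * I‖)
        (by simp) ((Measurable.ite measurableSet_Ioi measurable_const
          measurable_const).aestronglyMeasurable)
        (Eventually.of_forall fun t => by split_ifs <;> simp)
    have h3 : ContinuousOn (fun t : ℝ => (t : ℂ)⁻¹) (uIcc (1 / 2) M) := by
      refine ContinuousOn.inv₀ (by fun_prop) fun t ht => ?_
      rw [uIcc_of_le (by linarith)] at ht
      have : t ≠ 0 := by linarith [ht.1]
      exact_mod_cast this
    refine ((h1.add h2).mul_continuousOn h3).congr fun t _ => ?_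
    rw [realKernel, log_one_sub_ofReal, div_eq_mul_inv]
  refine (hleft.trans hright).mono_set ?_
  rw [uIcc_of_le (by linarith : -M ≤ M)]
  refine uIcc_subset_Icc ⟨?_, ?_⟩ ⟨?_, ?_⟩ <;> simp only [M] <;>
    linarith [abs_nonneg a, abs_nonneg b, le_abs_self a, le_abs_self b, neg_abs_le a, neg_abs_le b]

theorem continuous_dilogIntegral_ofReal : Continuous fun x : ℝ => dilogIntegral x := by
  simp_rw [dilogIntegral_ofReal]
  exact (intervalIntegral.continuous_primitive intervalIntegrable_realKernel 0).neg

/-- Termwise integration of `-log (1 - t) / t = ∑ tⁿ / (n + 1)` gives `ζ(2)`. -/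
theorem integral_neg_log_one_sub_div :
    ∫ t in Ioo (0 : ℝ) 1, -Real.log (1 - t) / t = Real.pi ^ 2 / 6 := by
  have hterm : ∀ n : ℕ, ∫ t in Ioo (0 : ℝ) 1, t ^ n / ((n : ℝ) + 1) = 1 / ((n : ℝ) + 1) ^ 2 := by
    intro n
    rw [← integral_Ioc_eq_integral_Ioo, ← intervalIntegral.integral_of_le zero_le_one,
      intervalIntegral.integral_div, integral_pow]
    have : (n : ℝ) + 1 ≠ 0 := by positivity
    field_simp
    simp
  have hint : ∀ n : ℕ, Integrable (fun t : ℝ => t ^ n / ((n : ℝ) + 1))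
      (volume.restrict (Ioo (0 : ℝ) 1)) := fun n =>
    ((by fun_prop : Continuous fun t : ℝ => t ^ n / ((n : ℝ) + 1)).integrableOn_Icc
      (a := 0) (b := 1)).mono_set Ioo_subset_Icc_self
  have hzeta : HasSum (fun n : ℕ => 1 / ((n : ℝ) + 1) ^ 2) (Real.pi ^ 2 / 6) := by
    have := (hasSum_nat_add_iff' 1).2 hasSum_zeta_two
    simpa using this
  have hnorm : ∀ n : ℕ, ∫ t in Ioo (0 : ℝ) 1, ‖t ^ n / ((n : ℝ) + 1)‖ = 1 / ((n : ℝ) + 1) ^ 2 := by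
    intro n
    rw [← hterm n]
    refine setIntegral_congr_fun measurableSet_Ioo fun t ht => ?_
    have := ht.1
    exact Real.norm_of_nonneg (by positivity)
  have h := hasSum_integral_of_summable_integral_norm hint
    (by simp_rw [hnorm]; exact hzeta.summable)
  simp_rw [hterm] at h
  rw [← h.unique hzeta]
  refine setIntegral_congr_fun measurableSet_Ioo fun t ht => ?_
  have h1 := (Real.hasSum_pow_div_log_of_abs_lt_one (abs_lt.2 ⟨by linarith [ht.1], ht.2⟩)).div_const t
  refine (Eq.trans (tsum_congr fun n => ?_) h1.tsum_eq).symm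
  have : t ≠ 0 := ht.1.ne'
  field_simp
  ring

theorem dilogIntegral_zero : dilogIntegral 0 = 0 := by simp [dilogIntegral]

theorem dilogIntegral_one : dilogIntegral 1 = (Real.pi : ℂ) ^ 2 / 6 := by
  have h := dilogIntegral_ofReal 1
  rw [ofReal_one] at h
  rw [h, intervalIntegral.integral_of_le zero_le_one, integral_Ioc_eq_integral_Ioo, ← integral_neg]
  have : ∫ t in Ioo (0 : ℝ) 1, -realKernel t =
      ∫ t in Ioo (0 : ℝ) 1, ((-Real.log (1 - t) / t : ℝ) : ℂ) := by
    refine setIntegral_congr_fun measurableSet_Ioo fun t ht => ?_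
    simp [realKernel, log_one_sub_ofReal, not_lt.2 ht.2.le, neg_div]
  rw [this, integral_complex_ofReal, integral_neg_log_one_sub_div]
  push_cast
  rfl

/-! ### The reflection formula for the dilogarithm. -/

theorem log_ofReal_mul_log_one_sub {x : ℝ} (hx : 0 < x) :
    log (x : ℂ) * log (1 - x) = -((dslope Real.log 1 x * ((1 - x) * Real.log (1 - x)) : ℝ) : ℂ)
      + (Real.log (max x 1) : ℂ) * (Real.pi * I) := by
  have h : Real.log x = (x - 1) * dslope Real.log 1 x := by
    have := sub_smul_dslope Real.log 1 x
    simpa using this.symm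
  rw [log_one_sub_ofReal, ← ofReal_log hx.le]
  split_ifs with h1
  · rw [max_eq_left h1.le]
    have : (Real.log x : ℂ) * Real.log (1 - x) =
        -((dslope Real.log 1 x * ((1 - x) * Real.log (1 - x)) : ℝ) : ℂ) := by
      rw [h]; push_cast; ring
    rw [mul_add, this]
  · rw [max_eq_right (not_lt.1 h1), h]; push_cast; simp; ring

/-- At `x = 1` the simple zero of `log x` absorbs both the logarithmic singularity of `log (1 - x)`
and its jump by `πi`. This allows the reflection formula to be normalized at `1`. -/
theorem continuousOn_log_mul_log_one_sub :
    ContinuousOn (fun x : ℝ => log (x : ℂ) * log (1 - x)) (Ioi 0) := by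
  have h1 : ContinuousOn (dslope Real.log 1) (Ioi 0) := by
    rw [continuousOn_dslope (Ioi_mem_nhds one_pos)]
    exact ⟨Real.continuousOn_log.mono fun x hx => ne_of_gt hx, Real.differentiableAt_log one_ne_zero⟩
  have h2 : Continuous fun x : ℝ => (1 - x) * Real.log (1 - x) :=
    Real.continuous_mul_log.comp (by fun_prop : Continuous fun x : ℝ => 1 - x)
  have h3 : Continuous fun x : ℝ => Real.log (max x 1) :=
    Continuous.log (by fun_prop) fun x => (lt_of_lt_of_le one_pos (le_max_right x 1)).ne'
  refine ContinuousOn.congr (f := fun x : ℝ =>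
    -((dslope Real.log 1 x * ((1 - x) * Real.log (1 - x)) : ℝ) : ℂ)
      + (Real.log (max x 1) : ℂ) * (Real.pi * I)) ?_ fun x hx => log_ofReal_mul_log_one_sub hx
  exact ((continuous_ofReal.comp_continuousOn (h1.mul h2.continuousOn)).neg).add
    ((continuous_ofReal.comp h3).mul continuous_const).continuousOn

theorem hasDerivAt_log_one_sub_ofReal {x : ℝ} (hx : 1 < x) :
    HasDerivAt (fun t : ℝ => log (1 - (t : ℂ))) (-1 / (1 - x)) x := by
  have h : HasDerivAt (fun t : ℝ => (Real.log (1 - t) : ℂ) + (Real.pi : ℂ) * I)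
      (-1 / (1 - x)) x := by
    have h1 : HasDerivAt (fun t : ℝ => Real.log (1 - t)) (-1 / (1 - x)) x := by
      simpa using ((hasDerivAt_id x).const_sub 1).log (by simp; linarith)
    exact (h1.ofReal_comp.add_const _).congr_deriv (by push_cast; rfl)
  refine h.congr_of_eventuallyEq ?_
  filter_upwards [lt_mem_nhds hx] with t ht
  rw [log_one_sub_ofReal, if_pos ht]

theorem hasDerivAt_dilogIntegral_ofReal {x : ℝ} (hx : 1 < x) :
    HasDerivAt (fun t : ℝ => dilogIntegral t) (-(log (1 - x) / x)) x := by
  simp_rw [dilogIntegral_ofReal]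
  have hx0 : (x : ℂ) ≠ 0 := by exact_mod_cast (by linarith : x ≠ 0)
  refine (intervalIntegral.integral_hasDerivAt_right (intervalIntegrable_realKernel 0 x) ?_ ?_).neg
  · exact (by unfold realKernel; fun_prop : Measurable realKernel).stronglyMeasurable.stronglyMeasurableAtFilter
  · exact (hasDerivAt_log_one_sub_ofReal hx).continuousAt.div continuous_ofReal.continuousAt hx0

theorem dilogIntegral_reflection_of_one_lt {x : ℝ} (hx : 1 < x) :
    dilogIntegral x + dilogIntegral (1 - x) + log x * log (1 - x) = (Real.pi : ℂ) ^ 2 / 6 := by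
  set H : ℝ → ℂ := fun x => dilogIntegral x + dilogIntegral (1 - x) + log x * log (1 - x) with hH
  have hcont : ContinuousOn H (Ioi 0) := by
    refine ContinuousOn.add (continuous_dilogIntegral_ofReal.add ?_).continuousOn
      continuousOn_log_mul_log_one_sub
    have := continuous_dilogIntegral_ofReal.comp (by fun_prop : Continuous fun x : ℝ => 1 - x)
    simpa [Function.comp_def] using this
  have hderiv : ∀ y : ℝ, 1 < y → HasDerivAt H 0 y := by
    intro y hy1
    have hy0 : (y : ℂ) ≠ 0 := by exact_mod_cast (by linarith : y ≠ 0)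
    have hy1' : (1 : ℂ) - y ≠ 0 := by exact_mod_cast (by linarith : 1 - y ≠ 0)
    have hslit : (y : ℂ) ∈ slitPlane := by simp; linarith
    have h1 := hasDerivAt_dilogIntegral_ofReal hy1
    have h2 := ((hasDerivAt_dilogIntegral (z := 1 - (y : ℂ)) (by simpa using hslit)
      hy1').comp_const_sub 1 (y : ℂ)).comp_ofReal
    have h3 := ((ofRealCLM.hasDerivAt (x := y)).clog_real hslit).mul
      (hasDerivAt_log_one_sub_ofReal hy1)
    refine ((h1.add h2).add h3).congr_deriv ?_
    simp only [sub_sub_cancel, ofRealCLM_apply, ofReal_one]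
    field_simp
    ring
  -- The constancy criterion needs right derivatives at every point except the right endpoint. Only
  -- continuity is known at `1`, so the interval is reversed to make `1` that endpoint.
  have hconst : H (-(-1)) = H (-(-x)) := by
    refine constant_of_has_deriv_right_zero (f := fun t => H (-t)) (a := -x) (b := -1)
      (hcont.comp (by fun_prop) fun t ht => ?_) (fun t ht => ?_) (-1) ⟨by linarith, le_rfl⟩
    · simp only [mem_Ioi]; linarith [ht.2]
    · have h := (hderiv (-t) (by linarith [ht.2])).scomp t (hasDerivAt_neg t)
      rw [smul_zero] at h
      exact h.hasDerivWithinAt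
  rw [neg_neg, neg_neg] at hconst
  rw [← dilogIntegral_one]
  refine (hconst.symm.trans ?_)
  simp [hH, dilogIntegral_zero]

theorem mem_cutDomain_iff {z : ℂ} : z ∈ cutDomain ↔ z ∈ slitPlane ∧ 1 - z ∈ slitPlane := by
  simp only [cutDomain, mem_ofPred_eq, mem_slitPlane_iff, sub_re, one_re, sub_im, one_im, zero_sub,
    ne_eq, neg_eq_zero, not_and_or, not_or, not_le, sub_pos]
  tauto

theorem isOpen_cutDomain : IsOpen cutDomain := by
  have : cutDomain = slitPlane ∩ {z : ℂ | 1 - z ∈ slitPlane} := by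
    ext z; exact mem_cutDomain_iff
  rw [this]
  exact isOpen_slitPlane.inter isOpen_one_sub_slitPlane

theorem isPreconnected_cutDomain : IsPreconnected cutDomain := by
  have hmid : (1 / 2 : ℂ) ∈ cutDomain := by norm_num [cutDomain]
  have hstar : StarConvex ℝ (1 / 2 : ℂ) cutDomain := by
    rw [starConvex_iff_forall_pos hmid]
    intro y hy a b ha hb hab
    simp only [cutDomain, mem_ofPred_eq, not_and_or, not_or, not_le] at hy ⊢
    have him : (a • (1 / 2 : ℂ) + b • y).im = b * y.im := by simp
    have hre : (a • (1 / 2 : ℂ) + b • y).re = a / 2 + b * y.re := by simp; ring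
    rw [him, hre]
    rcases hy with hy | hy
    · exact Or.inl (mul_ne_zero hb.ne' hy)
    · right
      constructor <;> nlinarith
  exact (hstar.isPathConnected hmid).isConnected.isPreconnected

theorem dilogIntegral_reflection {z : ℂ} (hz : z ∈ cutDomain) :
    dilogIntegral z + dilogIntegral (1 - z) + log z * log (1 - z) = (Real.pi : ℂ) ^ 2 / 6 := by
  set H : ℂ → ℂ := fun z => dilogIntegral z + dilogIntegral (1 - z) + log z * log (1 - z) with hH
  have hderiv : ∀ w ∈ cutDomain, HasDerivAt H 0 w := by
    intro w hw
    obtain ⟨h1, h2⟩ := mem_cutDomain_iff.1 hw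
    have h0 := slitPlane_ne_zero h1
    have h0' := slitPlane_ne_zero h2
    refine (((hasDerivAt_dilogIntegral h2 h0).add ((hasDerivAt_dilogIntegral (z := 1 - w)
      (by simpa using h1) h0').comp_const_sub 1 w)).add
      (((hasDerivAt_id w).clog h1).mul (hasDerivAt_log_one_sub h2))).congr_deriv ?_
    simp only [sub_sub_cancel, id]
    field_simp
    ring
  have hconst : ∀ w ∈ cutDomain, H w = H z := fun w hw =>
    isOpen_cutDomain.is_const_of_deriv_eq_zero isPreconnected_cutDomain
      (fun w hw => (hderiv w hw).differentiableAt.differentiableWithinAt)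
      (fun w hw => (hderiv w hw).deriv) hw hz
  have hcont : ContinuousOn (fun x : ℝ => H x) (Ioi 0) := by
    refine ContinuousOn.add (continuous_dilogIntegral_ofReal.add ?_).continuousOn
      continuousOn_log_mul_log_one_sub
    have := continuous_dilogIntegral_ofReal.comp (by fun_prop : Continuous fun x : ℝ => 1 - x)
    simpa [Function.comp_def] using this
  -- The constant is found by approaching the boundary point `1` along the real interval `(0, 1)`.
  have hlim : Tendsto (fun x : ℝ => H x) (𝓝[<] 1) (𝓝 (H 1)) := by
    have := (hcont.continuousAt (Ioi_mem_nhds one_pos)).tendsto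
    exact (by simpa using this : Tendsto _ _ _).mono_left nhdsWithin_le_nhds
  have hlim2 : Tendsto (fun x : ℝ => H x) (𝓝[<] 1) (𝓝 (H z)) := by
    refine tendsto_const_nhds.congr' ?_
    filter_upwards [Ioo_mem_nhdsLT one_pos] with x hx
    refine (hconst x ?_).symm
    simp [cutDomain, hx.1, hx.2]
  refine (tendsto_nhds_unique hlim2 hlim).trans ?_
  simp [hH, dilogIntegral_zero, dilogIntegral_one]

/-! ### Logarithmic coordinates on the cover and the extended Rogers dilogarithm -/

/-- The period `2πi` of the exponential function. -/
def tau : ℂ := 2 * Real.pi * I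

theorem tau_ne_zero : tau ≠ 0 := two_pi_I_ne_zero

theorem exp_tau : exp tau = 1 := exp_two_pi_mul_I

theorem exp_eq_exp_iff_tau {a b : ℂ} : exp a = exp b ↔ ∃ n : ℤ, a = b + n * tau :=
  exp_eq_exp_iff_exists_int

theorem exp_add_int_mul_tau (a : ℂ) (n : ℤ) : exp (a + n * tau) = exp a :=
  exp_eq_exp_iff_tau.2 ⟨n, rfl⟩

theorem conj_log_ofReal_of_neg {x : ℝ} (hx : x < 0) :
    (starRingEnd ℂ) (log (x : ℂ)) = log x - tau := by
  rw [Complex.log, arg_ofReal_of_neg hx, tau]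
  simp
  ring

theorem conj_log_ofReal_of_pos {x : ℝ} (hx : 0 < x) :
    (starRingEnd ℂ) (log (x : ℂ)) = log x := by
  rw [← ofReal_log hx.le, conj_ofReal]

theorem conj_log_one_sub_of_one_lt {x : ℝ} (hx : 1 < x) :
    (starRingEnd ℂ) (log (1 - (x : ℂ))) = log (1 - x) - tau := by
  have := conj_log_ofReal_of_neg (sub_neg.2 hx)
  push_cast at this
  exact this

theorem conj_log_one_sub_of_lt_one {x : ℝ} (hx : x < 1) :
    (starRingEnd ℂ) (log (1 - (x : ℂ))) = log (1 - x) := by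
  have := conj_log_ofReal_of_pos (sub_pos.2 hx)
  push_cast at this
  exact this

theorem conj_dilogIntegral_of_lt_one {x : ℝ} (hx : x < 1) :
    (starRingEnd ℂ) (dilogIntegral x) = dilogIntegral x := by
  have h : dilogIntegral x = ((-∫ t in (0 : ℝ)..x, Real.log (1 - t) / t : ℝ) : ℂ) := by
    rw [dilogIntegral_ofReal, ofReal_neg, ← intervalIntegral.integral_ofReal]
    congr 1
    refine intervalIntegral.integral_congr fun t ht => ?_
    have ht1 : ¬ 1 < t := by
      have := (mem_uIcc.1 ht)
      rcases this with h | h <;> linarith [h.2]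
    simp [realKernel, log_one_sub_ofReal, ht1]
  rw [h, conj_ofReal]

namespace CutPlane

theorem toComplex_ne_zero (z : CutPlane) : z.toComplex ≠ 0 := by
  cases z with
  | inner z hz => exact slitPlane_ne_zero (mem_cutDomain_iff.1 hz).1
  | above x hx =>
    have : x ≠ 0 := by rcases hx with h | h <;> intro h0 <;> linarith
    exact ofReal_ne_zero.2 this
  | below x hx =>
    have : x ≠ 0 := by rcases hx with h | h <;> intro h0 <;> linarith
    exact ofReal_ne_zero.2 this

theorem one_sub_toComplex_ne_zero (z : CutPlane) : 1 - z.toComplex ≠ 0 := by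
  cases z with
  | inner z hz => exact slitPlane_ne_zero (mem_cutDomain_iff.1 hz).2
  | above x hx =>
    have : 1 - x ≠ 0 := by rcases hx with h | h <;> intro h0 <;> linarith
    rw [← ofReal_ne_zero, ofReal_sub, ofReal_one] at this
    exact this
  | below x hx =>
    have : 1 - x ≠ 0 := by rcases hx with h | h <;> intro h0 <;> linarith
    rw [← ofReal_ne_zero, ofReal_sub, ofReal_one] at this
    exact this

theorem exp_log (z : CutPlane) : exp z.log = z.toComplex := by
  have h0 := z.toComplex_ne_zero
  cases z with
  | inner z hz => exact Complex.exp_log h0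
  | above x hx => exact Complex.exp_log h0
  | below x hx =>
    simp only [log, exp_conj]
    exact (congrArg _ (Complex.exp_log h0)).trans (conj_ofReal x)

theorem exp_logOneSub (z : CutPlane) : exp z.logOneSub = 1 - z.toComplex := by
  have h0 := z.one_sub_toComplex_ne_zero
  cases z with
  | inner z hz => exact Complex.exp_log h0
  | above x hx =>
    simp only [logOneSub, exp_conj]
    exact (congrArg _ (Complex.exp_log h0)).trans (by simp [toComplex])
  | below x hx => exact Complex.exp_log h0

/-- The coordinates `(Log z + 2πi p, Log (1 - z) - 2πi q)` of `(z; 2p, 2q)`. -/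
def coord (z : CutPlane) (p q : ℤ) : ℂ × ℂ := (z.log + p * tau, z.logOneSub - q * tau)

theorem exp_coord_fst (z : CutPlane) (p q : ℤ) : exp (z.coord p q).1 = z.toComplex := by
  rw [coord, exp_add_int_mul_tau, exp_log]

theorem exp_coord_snd (z : CutPlane) (p q : ℤ) : exp (z.coord p q).2 = 1 - z.toComplex := by
  have := exp_add_int_mul_tau z.logOneSub (-q)
  rw [coord, ← exp_logOneSub, ← this]
  push_cast
  congr 1
  ring

theorem coord_above_neg {x : ℝ} (hx : x < 0) (p q : ℤ) :
    (above x (Or.inl hx)).coord p q = (below x (Or.inl hx)).coord (p + 1) q := by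
  simp only [coord, log, logOneSub, conj_log_ofReal_of_neg hx,
    conj_log_one_sub_of_lt_one (hx.trans one_pos)]
  push_cast
  congr 1
  ring

theorem coord_above_gtOne {x : ℝ} (hx : 1 < x) (p q : ℤ) :
    (above x (Or.inr hx)).coord p q = (below x (Or.inr hx)).coord p (q + 1) := by
  simp only [coord, log, logOneSub, conj_log_ofReal_of_pos (one_pos.trans hx),
    conj_log_one_sub_of_one_lt hx]
  push_cast
  congr 1
  ring

/-- The cut along the negative axis concerns `Log z` only; there the dilogarithm and `Log (1 - z)`
are real, so the conjugation on the upper edge has no effect. -/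
theorem dilog_of_one_sub_mem_slitPlane (z : CutPlane) (hz : 1 - z.toComplex ∈ slitPlane) :
    z.dilog = dilogIntegral z.toComplex ∧ z.logOneSub = Complex.log (1 - z.toComplex) := by
  cases z with
  | inner z _ => exact ⟨rfl, rfl⟩
  | below x _ => exact ⟨rfl, rfl⟩
  | above x _ =>
    have hx : x < 1 := by simpa [toComplex, mem_slitPlane_iff] using hz
    exact ⟨conj_dilogIntegral_of_lt_one hx, conj_log_one_sub_of_lt_one hx⟩

/-- Reflection moves the cut `(1, ∞)` of the dilogarithm to that of `1 - z`, so a single formula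
covers both edges of it. -/
theorem dilog_of_mem_slitPlane (z : CutPlane) (hz : z.toComplex ∈ slitPlane) :
    z.dilog = (Real.pi : ℂ) ^ 2 / 6 - dilogIntegral (1 - z.toComplex) - z.log * z.logOneSub ∧
      z.log = Complex.log z.toComplex := by
  cases z with
  | inner z h =>
    refine ⟨?_, rfl⟩
    simp only [dilog, toComplex, log, logOneSub, ← dilogIntegral_reflection h]
    ring
  | below x h =>
    have hx : 0 < x := by simpa [toComplex, mem_slitPlane_iff] using hz
    have hx1 : 1 < x := by rcases h with h | h <;> linarith
    simp only [dilog, toComplex, log, logOneSub, ← dilogIntegral_reflection_of_one_lt hx1,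
      conj_log_ofReal_of_pos hx, and_true]
    ring
  | above x h =>
    have hx : 0 < x := by simpa [toComplex, mem_slitPlane_iff] using hz
    have hx1 : 1 < x := by rcases h with h | h <;> linarith
    have h1 := congrArg (starRingEnd ℂ) (dilogIntegral_reflection_of_one_lt hx1)
    have h2 := conj_dilogIntegral_of_lt_one (x := 1 - x) (by linarith)
    push_cast at h2
    simp only [map_add, map_mul, conj_log_ofReal_of_pos hx, h2] at h1
    have h3 : (starRingEnd ℂ) ((Real.pi : ℂ) ^ 2 / 6) = (Real.pi : ℂ) ^ 2 / 6 := by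
      rw [map_div₀, map_pow, conj_ofReal, map_ofNat]
    rw [h3] at h1
    simp only [dilog, toComplex, log, logOneSub, ← h1, and_true]
    ring

end CutPlane

/-- The Rogers dilogarithm in logarithmic coordinates, where `e ^ u ∉ [1, ∞)`. -/
def rogersLeft (w : ℂ × ℂ) : ℂ :=
  dilogIntegral (exp w.1) + w.1 * log (1 - exp w.1) - w.1 * w.2 / 2 - (Real.pi : ℂ) ^ 2 / 6

/-- The Rogers dilogarithm in logarithmic coordinates, where `e ^ v ∉ [1, ∞)`. -/
def rogersRight (w : ℂ × ℂ) : ℂ :=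
  -dilogIntegral (exp w.2) - w.2 * log (1 - exp w.2) + w.1 * w.2 / 2

theorem rogers_eq_rogersLeft (z : CutPlane) (hz : 1 - z.toComplex ∈ slitPlane) (p q : ℤ) :
    rogers z p q = rogersLeft (z.coord p q) := by
  obtain ⟨h1, h2⟩ := z.dilog_of_one_sub_mem_slitPlane hz
  rw [rogersLeft, CutPlane.exp_coord_fst, rogers, h1, ← h2, CutPlane.coord, tau]
  ring

/-- The discrepancy `p q (2πi)²` between the two charts is what forces values modulo `ℤ(2)`. -/
theorem rogers_sub_rogersRight (z : CutPlane) (hz : z.toComplex ∈ slitPlane) (p q : ℤ) :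
    rogers z p q - rogersRight (z.coord p q) = (p * q : ℤ) • (2 * (Real.pi : ℂ) * I) ^ 2 := by
  obtain ⟨h1, h2⟩ := z.dilog_of_mem_slitPlane hz
  rw [rogersRight, CutPlane.exp_coord_snd, rogers, h1, sub_sub_cancel, ← h2, CutPlane.coord, tau]
  simp only [zsmul_eq_mul]
  push_cast
  ring

theorem rogers_mk_eq_rogersRight (z : CutPlane) (hz : z.toComplex ∈ slitPlane) (p q : ℤ) :
    ((rogers z p q : ℂ) : ℂ ⧸ Z2) = (rogersRight (z.coord p q) : ℂ) := by
  rw [QuotientAddGroup.eq_iff_sub_mem, rogers_sub_rogersRight z hz]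
  exact AddSubgroup.zsmul_mem_zmultiples _ _

namespace Chat

/-- The logarithmic coordinates of a point of the cover. -/
def coord : Chat → ℂ × ℂ :=
  Quot.lift (fun a : CutPlane × ℤ × ℤ => a.1.coord a.2.1 a.2.2) (by
    intro a b h
    cases h with
    | neg x hx p q => exact CutPlane.coord_above_neg hx p q
    | gtOne x hx p q => exact CutPlane.coord_above_gtOne hx p q)

theorem coord_mk (z : CutPlane) (p q : ℤ) : (mk z p q).coord = z.coord p q := rfl

theorem proj_mk (z : CutPlane) (p q : ℤ) : (mk z p q).proj = z.toComplex := rfl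

theorem exists_mk (w : Chat) : ∃ z p q, w = mk z p q := by
  obtain ⟨⟨z, p, q⟩, rfl⟩ := Quot.exists_rep w
  exact ⟨z, p, q, rfl⟩

theorem exp_coord_fst (w : Chat) : exp w.coord.1 = w.proj := by
  obtain ⟨z, p, q, rfl⟩ := w.exists_mk
  exact z.exp_coord_fst p q

theorem exp_coord_snd (w : Chat) : exp w.coord.2 = 1 - w.proj := by
  obtain ⟨z, p, q, rfl⟩ := w.exists_mk
  exact z.exp_coord_snd p q

/-- The extended Rogers dilogarithm on the cover. -/
def lhat : Chat → ℂ ⧸ Z2 :=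
  Quot.lift (fun a : CutPlane × ℤ × ℤ => ((rogers a.1 a.2.1 a.2.2 : ℂ) : ℂ ⧸ Z2)) (by
    intro a b h
    cases h with
    | neg x hx p q =>
      have h1 : 1 - (x : ℂ) ∈ slitPlane := by simp [mem_slitPlane_iff]; linarith
      exact congrArg _ ((rogers_eq_rogersLeft (.above x (Or.inl hx)) h1 p q).trans
        ((congrArg _ (CutPlane.coord_above_neg hx p q)).trans
          (rogers_eq_rogersLeft (.below x (Or.inl hx)) h1 (p + 1) q).symm))
    | gtOne x hx p q =>
      have h1 : (x : ℂ) ∈ slitPlane := by simp [mem_slitPlane_iff]; linarith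
      exact (rogers_mk_eq_rogersRight (.above x (Or.inr hx)) h1 p q).trans
        ((congrArg (fun w => ((rogersRight w : ℂ) : ℂ ⧸ Z2))
          (CutPlane.coord_above_gtOne hx p q)).trans
          (rogers_mk_eq_rogersRight (.below x (Or.inr hx)) h1 p (q + 1)).symm))

theorem lhat_mk (z : CutPlane) (p q : ℤ) : (mk z p q).lhat = ((rogers z p q : ℂ) : ℂ ⧸ Z2) := rfl

theorem lhat_eq_rogersLeft (w : Chat) (hw : 1 - w.proj ∈ slitPlane) :
    w.lhat = (rogersLeft w.coord : ℂ) := by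
  obtain ⟨z, p, q, rfl⟩ := w.exists_mk
  rw [lhat_mk, rogers_eq_rogersLeft z hw, coord_mk]

theorem lhat_eq_rogersRight (w : Chat) (hw : w.proj ∈ slitPlane) :
    w.lhat = (rogersRight w.coord : ℂ) := by
  obtain ⟨z, p, q, rfl⟩ := w.exists_mk
  rw [lhat_mk, rogers_mk_eq_rogersRight z hw, coord_mk]

end Chat

/-! ### The differential of the Rogers dilogarithm. -/

theorem hasDerivAt_rogersLeft {u v : ℝ → ℂ} {u' v' : ℂ} {s : ℝ} (hu : HasDerivAt u u' s)
    (hv : HasDerivAt v v' s) (h : exp (u s) + exp (v s) = 1)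
    (h' : exp (u s) * u' + exp (v s) * v' = 0) (hs : exp (v s) ∈ slitPlane) :
    HasDerivAt (fun t => rogersLeft (u t, v t)) ((u s * v' - v s * u') / 2) s := by
  have hv1 : exp (v s) = 1 - exp (u s) := by rw [← h]; ring
  rw [hv1] at hs
  have h1 : HasDerivAt (fun t => dilogIntegral (exp (u t))) _ s :=
    HasDerivAt.scomp (g₁ := dilogIntegral) s (hasDerivAt_dilogIntegral hs (exp_ne_zero _)) hu.cexp
  have h2 : HasDerivAt (fun t => log (1 - exp (u t))) _ s := (hu.cexp.const_sub 1).clog_real hs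
  refine (((h1.add (hu.mul h2)).sub ((hu.mul hv).div_const 2)).sub_const _).congr_deriv ?_
  have h3 : -(exp (u s) * u') = exp (v s) * v' := by linear_combination -h'
  rw [h3, hv1]
  have := slitPlane_ne_zero hs
  have := exp_ne_zero (u s)
  simp only [smul_eq_mul]
  field_simp
  ring

/-- `rogersRight (u, v) = -rogersLeft (v, u) - π² / 6`, and the form `u dv - v du` changes sign
under the swap. -/
theorem hasDerivAt_rogersRight {u v : ℝ → ℂ} {u' v' : ℂ} {s : ℝ} (hu : HasDerivAt u u' s)
    (hv : HasDerivAt v v' s) (h : exp (u s) + exp (v s) = 1)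
    (h' : exp (u s) * u' + exp (v s) * v' = 0) (hs : exp (u s) ∈ slitPlane) :
    HasDerivAt (fun t => rogersRight (u t, v t)) ((u s * v' - v s * u') / 2) s := by
  have := (hasDerivAt_rogersLeft hv hu ((add_comm _ _).trans h) ((add_comm _ _).trans h') hs).neg.sub_const
    ((Real.pi : ℂ) ^ 2 / 6)
  refine (this.congr_of_eventuallyEq (Eventually.of_forall fun t => ?_)).congr_deriv (by ring)
  simp only [rogersRight, rogersLeft, Pi.neg_apply]
  ring

/-! ### The logarithmic coordinates are a homeomorphism onto `{e ^ u + e ^ v = 1}` -/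

theorem continuousOn_round_re {X : Type*} [TopologicalSpace X] {f : X → ℂ} {s : Set X}
    (hf : ContinuousOn f s) (hs : ∀ x ∈ s, ∃ n : ℤ, f x = n) :
    ContinuousOn (fun x => round (f x).re) s := by
  rw [Int.isClosedEmbedding_coe_real.isInducing.continuousOn_iff]
  refine (continuous_re.comp_continuousOn hf).congr fun x hx => ?_
  obtain ⟨n, hn⟩ := hs x hx
  simp [hn]

theorem continuousOn_log_im_nonneg : ContinuousOn log {z : ℂ | 0 ≤ z.im ∧ z ≠ 0} := by
  intro z hz
  by_cases h : z ∈ slitPlane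
  · exact (continuousAt_clog h).continuousWithinAt
  · simp only [mem_slitPlane_iff, not_or, not_lt, ne_eq, not_not] at h
    have hre : z.re < 0 := lt_of_le_of_ne h.1 fun h0 => hz.2 (Complex.ext h0 h.2)
    exact (continuousWithinAt_log_of_re_neg_of_im_zero hre h.2).mono fun w hw => hw.1

theorem lt_zero_or_one_lt {z : ℂ} (h : z ∉ cutDomain) (h0 : z ≠ 0) (h1 : z ≠ 1) :
    z.im = 0 ∧ (z.re < 0 ∨ 1 < z.re) := by
  simp only [cutDomain, mem_ofPred_eq, not_not] at h
  refine ⟨h.1, h.2.imp (fun h2 => lt_of_le_of_ne h2 fun h3 => h0 (Complex.ext h3 h.1))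
    fun h2 => lt_of_le_of_ne h2 fun h3 => h1 (Complex.ext h3.symm h.1)⟩

namespace CutPlane

theorem isInducing_logs :
    Topology.IsInducing (fun z : CutPlane => (z.log, z.logOneSub)) := ⟨rfl⟩

open Classical in
/-- The point of the completed cut plane over `z`, on the upper edge of the cut if `z` is real. -/
def upper (z : ℂ) (h0 : z ≠ 0) (h1 : z ≠ 1) : CutPlane :=
  if h : z ∈ cutDomain then inner z h else above z.re (lt_zero_or_one_lt h h0 h1).2

open Classical in
/-- The point of the completed cut plane over `z`, on the lower edge of the cut if `z` is real. -/
def lower (z : ℂ) (h0 : z ≠ 0) (h1 : z ≠ 1) : CutPlane :=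
  if h : z ∈ cutDomain then inner z h else below z.re (lt_zero_or_one_lt h h0 h1).2

variable {z : ℂ} {h0 : z ≠ 0} {h1 : z ≠ 1}

theorem ofReal_re_of_notMem (h : z ∉ cutDomain) (h0 : z ≠ 0) (h1 : z ≠ 1) : (z.re : ℂ) = z :=
  Complex.ext rfl (lt_zero_or_one_lt h h0 h1).1.symm

theorem conj_log_conj (h : z ∈ slitPlane) :
    (starRingEnd ℂ) (Complex.log ((starRingEnd ℂ) z)) = Complex.log z := by
  rw [Complex.log_conj _ (mem_slitPlane_iff_arg.1 h).1, conj_conj]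

theorem log_upper : (upper z h0 h1).log = Complex.log z := by
  unfold upper
  split_ifs with h
  · rfl
  · simp only [log, ofReal_re_of_notMem h h0 h1]

theorem logOneSub_upper : (upper z h0 h1).logOneSub =
    (starRingEnd ℂ) (Complex.log ((starRingEnd ℂ) (1 - z))) := by
  unfold upper
  split_ifs with h
  · exact (conj_log_conj (mem_cutDomain_iff.1 h).2).symm
  · have : (starRingEnd ℂ) (1 - z) = 1 - (z.re : ℂ) := by
      rw [← ofReal_re_of_notMem h h0 h1]; simp
    rw [this]; rfl

theorem log_lower : (lower z h0 h1).log =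
    (starRingEnd ℂ) (Complex.log ((starRingEnd ℂ) z)) := by
  unfold lower
  split_ifs with h
  · exact (conj_log_conj (mem_cutDomain_iff.1 h).1).symm
  · have : (starRingEnd ℂ) z = (z.re : ℂ) := by
      rw [← ofReal_re_of_notMem h h0 h1]; simp
    rw [this]; rfl

theorem logOneSub_lower : (lower z h0 h1).logOneSub = Complex.log (1 - z) := by
  unfold lower
  split_ifs with h
  · rfl
  · simp only [logOneSub, ofReal_re_of_notMem h h0 h1]

theorem toComplex_upper : (upper z h0 h1).toComplex = z := by
  unfold upper
  split_ifs with h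
  · rfl
  · exact ofReal_re_of_notMem h h0 h1

end CutPlane

namespace Chat

theorem proj_ne_zero (w : Chat) : w.proj ≠ 0 := by
  rw [← exp_coord_fst]; exact exp_ne_zero _

theorem proj_ne_one (w : Chat) : w.proj ≠ 1 := by
  intro h
  have := exp_coord_snd w
  rw [h, sub_self] at this
  exact exp_ne_zero _ this

theorem mk_above_neg {x : ℝ} (hx : x < 0) (p q : ℤ) :
    mk (.above x (Or.inl hx)) p q = mk (.below x (Or.inl hx)) (p + 1) q :=
  Quot.sound (.neg x hx p q)

theorem mk_above_gtOne {x : ℝ} (hx : 1 < x) (p q : ℤ) :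
    mk (.above x (Or.inr hx)) p q = mk (.below x (Or.inr hx)) p (q + 1) :=
  Quot.sound (.gtOne x hx p q)

theorem exists_mk_upper (w : Chat) :
    ∃ p q, w = mk (CutPlane.upper w.proj w.proj_ne_zero w.proj_ne_one) p q := by
  obtain ⟨z, p, q, rfl⟩ := w.exists_mk
  simp only [proj_mk]
  cases z with
  | inner z h => exact ⟨p, q, by simp [CutPlane.upper, CutPlane.toComplex, h]⟩
  | above x h =>
    have h' : (x : ℂ) ∉ cutDomain := by
      simp only [cutDomain, mem_ofPred_eq, not_not]
      exact ⟨ofReal_im x, h.imp le_of_lt le_of_lt⟩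
    exact ⟨p, q, by simp [CutPlane.upper, CutPlane.toComplex, h']⟩
  | below x h =>
    have h' : (x : ℂ) ∉ cutDomain := by
      simp only [cutDomain, mem_ofPred_eq, not_not]
      exact ⟨ofReal_im x, h.imp le_of_lt le_of_lt⟩
    rcases h with h | h
    · exact ⟨p - 1, q, by simp [CutPlane.upper, CutPlane.toComplex, h', mk_above_neg h]⟩
    · exact ⟨p, q - 1, by simp [CutPlane.upper, CutPlane.toComplex, h', mk_above_gtOne h]⟩

theorem exists_mk_lower (w : Chat) :
    ∃ p q, w = mk (CutPlane.lower w.proj w.proj_ne_zero w.proj_ne_one) p q := by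
  obtain ⟨p, q, h⟩ := w.exists_mk_upper
  have h0 := w.proj_ne_zero
  have h1 := w.proj_ne_one
  by_cases hz : w.proj ∈ cutDomain
  · have : CutPlane.upper w.proj h0 h1 = CutPlane.lower w.proj h0 h1 := by
      simp [CutPlane.upper, CutPlane.lower, hz]
    exact ⟨p, q, by rw [← this]; exact h⟩
  · have hu : CutPlane.upper w.proj h0 h1 = .above w.proj.re (lt_zero_or_one_lt hz h0 h1).2 := by
      simp [CutPlane.upper, hz]
    have hl : CutPlane.lower w.proj h0 h1 = .below w.proj.re (lt_zero_or_one_lt hz h0 h1).2 := by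
      simp [CutPlane.lower, hz]
    rw [hu] at h
    rw [hl]
    rcases (lt_zero_or_one_lt hz h0 h1).2 with hx | hx
    · exact ⟨p + 1, q, h.trans (mk_above_neg hx p q)⟩
    · exact ⟨p, q + 1, h.trans (mk_above_gtOne hx p q)⟩

/-- Equal coordinates have equal exponentials, so both points can be written over the same point of
the upper section; the coordinates then determine the two integers. -/
theorem coord_injective : Function.Injective coord := by
  intro w w' h
  have hp : w.proj = w'.proj := by rw [← exp_coord_fst, ← exp_coord_fst, h]
  obtain ⟨p, q, hw⟩ := w.exists_mk_upper
  obtain ⟨p', q', hw'⟩ := w'.exists_mk_upper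
  have hu : CutPlane.upper w.proj w.proj_ne_zero w.proj_ne_one =
      CutPlane.upper w'.proj w'.proj_ne_zero w'.proj_ne_one := by simp only [hp]
  rw [hu] at hw
  clear hu
  generalize CutPlane.upper w'.proj w'.proj_ne_zero w'.proj_ne_one = ζ at hw hw'
  rw [hw, hw'] at h
  simp only [coord_mk, CutPlane.coord, Prod.mk.injEq, add_right_inj, sub_right_inj,
    mul_eq_mul_right_iff, tau_ne_zero, or_false, Int.cast_inj] at h
  rw [hw, hw', h.1, h.2]

theorem exists_coord_eq {w : ℂ × ℂ} (hw : exp w.1 + exp w.2 = 1) : ∃ a : Chat, a.coord = w := by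
  have h1 : exp w.1 ≠ 1 := fun h => exp_ne_zero w.2 (by linear_combination hw - h)
  set z := CutPlane.upper (exp w.1) (exp_ne_zero _) h1 with hz
  have hl : exp w.1 = exp z.log := by rw [CutPlane.exp_log, hz, CutPlane.toComplex_upper]
  have hr : exp w.2 = exp z.logOneSub := by
    rw [CutPlane.exp_logOneSub, hz, CutPlane.toComplex_upper, ← hw]; ring
  obtain ⟨p, hp⟩ := exp_eq_exp_iff_tau.1 hl
  obtain ⟨q, hq⟩ := exp_eq_exp_iff_tau.1 hr
  refine ⟨mk z p (-q), ?_⟩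
  rw [coord_mk, CutPlane.coord, ← hp]
  push_cast
  rw [neg_mul, sub_neg_eq_add, ← hq]

theorem continuous_coord : Continuous coord := by
  refine continuous_quot_lift _ ?_
  have h1 : Continuous CutPlane.log := continuous_fst.comp CutPlane.isInducing_logs.continuous
  have h2 : Continuous CutPlane.logOneSub :=
    continuous_snd.comp CutPlane.isInducing_logs.continuous
  have h3 : Continuous fun n : ℤ => (n : ℂ) := continuous_of_discreteTopology
  exact ((h1.comp continuous_fst).add
    ((h3.comp (continuous_fst.comp continuous_snd)).mul continuous_const)).prodMk
    ((h2.comp continuous_fst).sub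
    ((h3.comp (continuous_snd.comp continuous_snd)).mul continuous_const))

end Chat

instance : Nonempty Chat := ⟨Chat.mk (.above (-1) (Or.inl (by norm_num))) 0 0⟩

/-- The point of the cover with given logarithmic coordinates. -/
def chat : ℂ × ℂ → Chat := Function.invFun Chat.coord

theorem chat_coord (w : Chat) : chat w.coord = w :=
  Function.leftInverse_invFun Chat.coord_injective w

theorem coord_chat {w : ℂ × ℂ} (hw : exp w.1 + exp w.2 = 1) : (chat w).coord = w :=
  Function.invFun_eq (Chat.exists_coord_eq hw)

theorem proj_chat {w : ℂ × ℂ} (hw : exp w.1 + exp w.2 = 1) : (chat w).proj = exp w.1 := by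
  rw [← Chat.exp_coord_fst, coord_chat hw]

/-- A subset of `{e ^ u + e ^ v = 1}` on which a section of the completed cut plane over `e ^ u` is
continuous and reaches every point of the cover lifts continuously to the cover. -/
theorem continuousOn_chat_of_section {A : Set (ℂ × ℂ)} (hA : ∀ w ∈ A, exp w.1 + exp w.2 = 1)
    (σ : ℂ × ℂ → CutPlane) (hσ : ∀ w ∈ A, ∃ p q, chat w = Chat.mk (σ w) p q)
    (h1 : ContinuousOn (fun w => (σ w).log) A) (h2 : ContinuousOn (fun w => (σ w).logOneSub) A) :
    ContinuousOn chat A := by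
  have hpq : ∀ w ∈ A, ∃ p q : ℤ, chat w = Chat.mk (σ w) p q ∧
      (w.1 - (σ w).log) / tau = p ∧ ((σ w).logOneSub - w.2) / tau = q := by
    intro w hw
    obtain ⟨p, q, h⟩ := hσ w hw
    have hc : w = (σ w).coord p q := by
      rw [← Chat.coord_mk, ← h, coord_chat (hA w hw)]
    have hc1 : w.1 = (σ w).log + p * tau := congrArg Prod.fst hc
    have hc2 : w.2 = (σ w).logOneSub - q * tau := congrArg Prod.snd hc
    have := tau_ne_zero
    exact ⟨p, q, h, by rw [hc1]; field_simp; ring, by rw [hc2]; field_simp; ring⟩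
  have hp := continuousOn_round_re
    (f := fun w : ℂ × ℂ => (w.1 - (σ w).log) / tau) (s := A)
    ((continuousOn_fst.sub h1).div_const _)
    (fun w hw => by obtain ⟨p, q, h⟩ := hpq w hw; exact ⟨p, h.2.1⟩)
  have hq := continuousOn_round_re
    (f := fun w : ℂ × ℂ => ((σ w).logOneSub - w.2) / tau) (s := A)
    ((h2.sub continuousOn_snd).div_const _)
    (fun w hw => by obtain ⟨p, q, h⟩ := hpq w hw; exact ⟨q, h.2.2⟩)
  have hs : ContinuousOn σ A :=
    CutPlane.isInducing_logs.continuousOn_iff.2 (h1.prodMk h2)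
  have hq' : Continuous (Quot.mk ChatRel) := continuous_quot_mk
  refine (hq'.comp_continuousOn (hs.prodMk (hp.prodMk hq))).congr fun w hw => ?_
  obtain ⟨p, q, h, h3, h4⟩ := hpq w hw
  rw [h, Function.comp_apply]
  simp only [h3, h4, intCast_re, round_intCast]
  rfl

/-- Neither edge of the cuts gives a continuous section over the whole curve. The upper one is
continuous on the closed part `Im e ^ u ≥ 0` and the lower one on `Im e ^ u ≤ 0`; two closed pieces
glue. -/
theorem continuousOn_chat : ContinuousOn chat {w | exp w.1 + exp w.2 = 1} := by
  have hE : IsClosed {w : ℂ × ℂ | exp w.1 + exp w.2 = 1} :=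
    isClosed_eq (by fun_prop) continuous_const
  have hne : ∀ {w : ℂ × ℂ}, exp w.1 + exp w.2 = 1 → exp w.1 ≠ 1 := fun {w} hw h =>
    exp_ne_zero w.2 (by linear_combination hw - h)
  have him : Continuous fun w : ℂ × ℂ => (exp w.1).im := by fun_prop
  set A : Set (ℂ × ℂ) := {w | exp w.1 + exp w.2 = 1} ∩ {w | 0 ≤ (exp w.1).im}
  set B : Set (ℂ × ℂ) := {w | exp w.1 + exp w.2 = 1} ∩ {w | (exp w.1).im ≤ 0}
  have hAB : {w : ℂ × ℂ | exp w.1 + exp w.2 = 1} = A ∪ B := by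
    rw [← inter_union_distrib_left]
    refine (inter_eq_left.2 fun w _ => ?_).symm
    exact le_total (0 : ℝ) (exp w.1).im
  classical
  rw [hAB]
  refine ContinuousOn.union_of_isClosed ?_ ?_ (hE.inter (isClosed_le continuous_const him))
    (hE.inter (isClosed_le him continuous_const))
  · set σ : ℂ × ℂ → CutPlane := fun w => if h : exp w.1 ≠ 1 then
      CutPlane.upper (exp w.1) (exp_ne_zero _) h else .above (-1) (Or.inl (by norm_num))
    have hσ : ∀ w (hw : w ∈ A), σ w = CutPlane.upper (exp w.1) (exp_ne_zero _) (hne hw.1) :=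
      fun w hw => dif_pos (hne hw.1)
    refine continuousOn_chat_of_section (fun w hw => hw.1) σ (fun w hw => ?_) ?_ ?_
    · obtain ⟨p, q, h⟩ := (chat w).exists_mk_upper
      exact ⟨p, q, by rw [hσ w hw]; simpa only [proj_chat hw.1] using h⟩
    · refine ContinuousOn.congr (f := fun w : ℂ × ℂ => log (exp w.1)) ?_
        fun w hw => by rw [hσ w hw, CutPlane.log_upper]
      exact continuousOn_log_im_nonneg.comp (by fun_prop) fun w hw => ⟨hw.2, exp_ne_zero _⟩
    · refine ContinuousOn.congr
        (f := fun w : ℂ × ℂ => (starRingEnd ℂ) (log ((starRingEnd ℂ) (exp w.2)))) ?_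
        fun w hw => ?_
      · refine continuous_conj.comp_continuousOn (continuousOn_log_im_nonneg.comp
          (continuous_conj.comp (by fun_prop)).continuousOn fun w hw => ⟨?_, ?_⟩)
        · have h1 : (exp w.1).im + (exp w.2).im = 0 := by rw [← add_im, hw.1, one_im]
          have h2 : 0 ≤ (exp w.1).im := hw.2
          simp only [conj_im]; linarith
        · simp [exp_ne_zero]
      · have : exp w.2 = 1 - exp w.1 := by rw [← hw.1]; ring
        rw [hσ w hw, CutPlane.logOneSub_upper, ← this]
  · set σ : ℂ × ℂ → CutPlane := fun w => if h : exp w.1 ≠ 1 then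
      CutPlane.lower (exp w.1) (exp_ne_zero _) h else .above (-1) (Or.inl (by norm_num))
    have hσ : ∀ w (hw : w ∈ B), σ w = CutPlane.lower (exp w.1) (exp_ne_zero _) (hne hw.1) :=
      fun w hw => dif_pos (hne hw.1)
    refine continuousOn_chat_of_section (fun w hw => hw.1) σ (fun w hw => ?_) ?_ ?_
    · obtain ⟨p, q, h⟩ := (chat w).exists_mk_lower
      exact ⟨p, q, by rw [hσ w hw]; simpa only [proj_chat hw.1] using h⟩
    · refine ContinuousOn.congr
        (f := fun w : ℂ × ℂ => (starRingEnd ℂ) (log ((starRingEnd ℂ) (exp w.1)))) ?_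
        fun w hw => by rw [hσ w hw, CutPlane.log_lower]
      refine continuous_conj.comp_continuousOn (continuousOn_log_im_nonneg.comp
        (continuous_conj.comp (by fun_prop)).continuousOn fun w hw => ⟨?_, ?_⟩)
      · have h2 : (exp w.1).im ≤ 0 := hw.2
        simp only [conj_im]; linarith
      · simp [exp_ne_zero]
    · refine ContinuousOn.congr (f := fun w : ℂ × ℂ => log (exp w.2)) ?_ fun w hw => ?_
      · refine continuousOn_log_im_nonneg.comp (by fun_prop) fun w hw => ⟨?_, exp_ne_zero _⟩
        have h1 : (exp w.1).im + (exp w.2).im = 0 := by rw [← add_im, hw.1, one_im]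
        have h2 : (exp w.1).im ≤ 0 := hw.2
        linarith
      · have : exp w.2 = 1 - exp w.1 := by rw [← hw.1]; ring
        rw [hσ w hw, CutPlane.logOneSub_lower, ← this]

/-! ### The universal abelian cover of the complement of a hyperplane arrangement is connected -/

section Arrangement

variable {ι V : Type*} [AddCommGroup V] [Module ℂ V]

/-- The space of all logarithms of the values of a family of affine functions at a point where none
of them vanishes. -/
def logCover (f : ι → V →ᵃ[ℂ] ℂ) : Set (ι → ℂ) := {g | ∃ P, ∀ j, exp (g j) = f j P}

theorem apply_lineMap_eq (f : V →ᵃ[ℂ] ℂ) (P Q : V) (s : ℂ) :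
    f (AffineMap.lineMap P Q s) = f P + s * (f Q - f P) := by
  rw [AffineMap.apply_lineMap, AffineMap.lineMap_apply, vsub_eq_sub, vadd_eq_add, smul_eq_mul]
  ring

/-- A segment starting at `1` that reaches the negative axis is real and has already passed through
`0`. So avoiding `0` suffices for the principal logarithm to be continuous along it. -/
theorem segment_mem_slitPlane {r : ℂ} (h : ∀ t ∈ Icc (0 : ℝ) 1, 1 + t * (r - 1) ≠ 0) {t : ℝ}
    (ht : t ∈ Icc (0 : ℝ) 1) : 1 + t * (r - 1) ∈ slitPlane := by
  by_contra hn
  simp only [mem_slitPlane_iff, not_or, not_lt, ne_eq, not_not, add_re, one_re, re_ofReal_mul,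
    sub_re, add_im, one_im, im_ofReal_mul, sub_im, sub_zero, zero_add] at hn
  obtain ⟨hre, him⟩ := hn
  have ht0 : 0 < t := lt_of_le_of_ne ht.1 fun h0 => by rw [← h0] at hre; norm_num at hre
  have hr : r.im = 0 := by simpa [ht0.ne'] using him
  have hr1 : 0 < 1 - r.re := by by_contra hc; nlinarith
  refine h (1 / (1 - r.re)) ⟨by positivity, ?_⟩ (Complex.ext ?_ ?_)
  · rw [div_le_one hr1]; nlinarith [ht.2]
  · simp only [add_re, one_re, re_ofReal_mul, sub_re, zero_re]
    field_simp
    ring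
  · simp only [add_im, one_im, im_ofReal_mul, sub_im, zero_im, hr]
    ring

theorem exists_joinedIn_of_segment {f : ι → V →ᵃ[ℂ] ℂ} {g : ι → ℂ} {P Q : V}
    (hg : ∀ j, exp (g j) = f j P)
    (hseg : ∀ t ∈ Icc (0 : ℝ) 1, ∀ j, f j (AffineMap.lineMap P Q (t : ℂ)) ≠ 0) :
    ∃ g', (∀ j, exp (g' j) = f j Q) ∧ JoinedIn (logCover f) g g' := by
  have hP : ∀ j, f j P ≠ 0 := fun j => by rw [← hg j]; exact exp_ne_zero _
  set γ : ℝ → ι → ℂ := fun t j => g j + log (1 + t * (f j Q / f j P - 1)) with hγ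
  have heq : ∀ (t : ℝ) j, f j P * (1 + t * (f j Q / f j P - 1)) =
      f j (AffineMap.lineMap P Q (t : ℂ)) := by
    intro t j
    have := hP j
    rw [apply_lineMap_eq]
    field_simp
  have hne : ∀ j, ∀ t ∈ Icc (0 : ℝ) 1, 1 + t * (f j Q / f j P - 1) ≠ 0 := fun j t ht h0 =>
    hseg t ht j (by rw [← heq, h0, mul_zero])
  have hexp : ∀ t ∈ Icc (0 : ℝ) 1, ∀ j, exp (γ t j) = f j (AffineMap.lineMap P Q (t : ℂ)) := by
    intro t ht j
    rw [hγ, exp_add, hg, exp_log (hne j t ht), heq]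
  refine ⟨γ 1, fun j => ?_, JoinedIn.ofLine (f := γ) ?_ ?_ rfl ?_⟩
  · simpa using hexp 1 ⟨zero_le_one, le_rfl⟩ j
  · refine continuousOn_pi.2 fun j => continuousOn_const.add (ContinuousOn.clog (by fun_prop) ?_)
    exact fun t ht => segment_mem_slitPlane (hne j) ht
  · ext j; simp [hγ]
  · rintro _ ⟨t, ht, rfl⟩
    exact ⟨_, hexp t ht⟩

/-- The complex line through `P` and `Q` meets the hyperplanes in finitely many points, so a path
with one corner avoids them, and logarithms are carried along its two segments. -/
theorem exists_joinedIn [Finite ι] {f : ι → V →ᵃ[ℂ] ℂ} {g : ι → ℂ} (hg : g ∈ logCover f) {Q : V}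
    (hQ : ∀ j, f j Q ≠ 0) : ∃ g', (∀ j, exp (g' j) = f j Q) ∧ JoinedIn (logCover f) g g' := by
  obtain ⟨P, hg⟩ := hg
  have hP : ∀ j, f j P ≠ 0 := fun j => by rw [← hg j]; exact exp_ne_zero _
  set bad : Set ℂ := {s | ∃ j, f j (AffineMap.lineMap P Q s) = 0} with hbad
  have hfin : bad.Finite := by
    refine (Set.finite_range fun j => -f j P / (f j Q - f j P)).subset ?_
    rintro s ⟨j, hj⟩
    rw [apply_lineMap_eq] at hj
    have hne : f j Q - f j P ≠ 0 := fun h0 => hP j (by rw [h0, mul_zero, add_zero] at hj; exact hj)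
    exact ⟨j, by simp only; rw [div_eq_iff hne]; linear_combination -hj⟩
  have h0 : (0 : ℂ) ∉ bad := by rintro ⟨j, hj⟩; exact hP j (by simpa using hj)
  have h1 : (1 : ℂ) ∉ bad := by rintro ⟨j, hj⟩; exact hQ j (by simpa using hj)
  -- The corner is `1 / 2 + i y`. A bad `s` on the segment from `0` forces `y = Im s / (2 Re s)`,
  -- one on the segment to `1` forces `y = Im s / (2 - 2 Re s)`.
  obtain ⟨y, hy⟩ := ((hfin.image fun s => s.im / (2 * s.re)).union
    (hfin.image fun s => s.im / (2 - 2 * s.re))).exists_notMem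
  rw [mem_union, not_or] at hy
  set s₀ : ℂ := ⟨1 / 2, y⟩ with hs₀
  set R := AffineMap.lineMap P Q s₀ with hR
  have hline1 : ∀ s : ℂ, AffineMap.lineMap P R s = AffineMap.lineMap P Q (s * s₀) := by
    intro s
    simp only [hR, AffineMap.lineMap_apply_module]
    module
  have hline2 : ∀ s : ℂ, AffineMap.lineMap R Q s = AffineMap.lineMap P Q (s₀ + s * (1 - s₀)) := by
    intro s
    simp only [hR, AffineMap.lineMap_apply_module]
    module
  obtain ⟨g₁, hg₁, hj₁⟩ := exists_joinedIn_of_segment (Q := R) hg (fun t ht j hj => by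
    rw [hline1] at hj
    have hb : (t : ℂ) * s₀ ∈ bad := ⟨j, hj⟩
    have ht0 : t ≠ 0 := by rintro rfl; simp [h0] at hb
    refine hy.1 ⟨_, hb, ?_⟩
    simp only [re_ofReal_mul, im_ofReal_mul, hs₀]
    field_simp)
  obtain ⟨g₂, hg₂, hj₂⟩ := exists_joinedIn_of_segment (P := R) (Q := Q) hg₁ (fun t ht j hj => by
    rw [hline2] at hj
    have hb : s₀ + (t : ℂ) * (1 - s₀) ∈ bad := ⟨j, hj⟩
    have ht0 : 1 - t ≠ 0 := by
      intro h
      have : t = 1 := by linarith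
      subst this
      simp [h1] at hb
    refine hy.2 ⟨_, hb, ?_⟩
    simp only [add_re, add_im, re_ofReal_mul, im_ofReal_mul, sub_re, sub_im, one_re, one_im, hs₀]
    have : 2 - 2 * (1 / 2 + t * (1 - 1 / 2)) = 1 - t := by ring
    rw [this]
    field_simp
    ring)
  exact ⟨g₂, hg₂, hj₁.trans hj₂⟩

theorem add_int_mul_tau_mem_logCover {f : ι → V →ᵃ[ℂ] ℂ} {g : ι → ℂ} (hg : g ∈ logCover f)
    (n : ι → ℤ) : (fun j => g j + n j * tau) ∈ logCover f := by
  obtain ⟨P, hP⟩ := hg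
  exact ⟨P, fun j => by rw [exp_add_int_mul_tau, hP]⟩

theorem joinedIn_add_int_mul_tau {f : ι → V →ᵃ[ℂ] ℂ} {g h : ι → ℂ}
    (hgh : JoinedIn (logCover f) g h) (n : ι → ℤ) :
    JoinedIn (logCover f) (fun j => g j + n j * tau) (fun j => h j + n j * tau) := by
  have hc : Continuous fun (g : ι → ℂ) j => g j + n j * tau := by fun_prop
  obtain ⟨γ, hγ⟩ := hgh
  exact ⟨γ.map hc, fun t => add_int_mul_tau_mem_logCover (hγ t) n⟩

/-- On a small circle around a point of the `k`-th hyperplane lying on no other one, `f k` winds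
once around `0`, while each other `f j` stays in a disc around `f j P` that misses `0`. -/
theorem exists_loop [Finite ι] [DecidableEq ι] {f : ι → V →ᵃ[ℂ] ℂ} {P Q : V} {k : ι} (hk : f k P = 0)
    (hP : ∀ j, j ≠ k → f j P ≠ 0) (hQ : ∀ j, f j Q ≠ 0) :
    ∃ g, JoinedIn (logCover f) g (fun j => g j + (Pi.single k 1 : ι → ℤ) j * tau) := by
  have hev : ∀ᶠ r : ℝ in 𝓝[>] 0, ∀ j, j ≠ k → r * ‖(f j Q - f j P) / f j P‖ < 1 := by
    refine eventually_all.2 fun j => ?_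
    have : Tendsto (fun r : ℝ => r * ‖(f j Q - f j P) / f j P‖) (𝓝[>] 0) (𝓝 0) := by
      have : Continuous fun r : ℝ => r * ‖(f j Q - f j P) / f j P‖ := by fun_prop
      simpa using (this.tendsto 0).mono_left nhdsWithin_le_nhds
    filter_upwards [this.eventually_lt_const one_pos] with r hr _ using hr
  obtain ⟨r, hr, hr0⟩ := (hev.and self_mem_nhdsWithin).exists
  have hr0 : 0 < r := hr0
  have hslit : ∀ j, j ≠ k → ∀ t : ℝ,
      1 + r * exp (t * tau) * ((f j Q - f j P) / f j P) ∈ slitPlane := by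
    intro j hj t
    refine mem_slitPlane_of_norm_lt_one ?_
    have : ‖exp ((t : ℂ) * tau)‖ = 1 := by
      have h : (t : ℂ) * tau = (t * (2 * Real.pi) : ℝ) * I := by rw [tau]; push_cast; ring
      rw [h, norm_exp_ofReal_mul_I]
    rw [norm_mul, norm_mul, this, mul_one, norm_real, Real.norm_of_nonneg hr0.le]
    exact hr j hj
  set γ : ℝ → ι → ℂ := fun t j => if j = k then log (r * f k Q) + t * tau else
    log (f j P) + log (1 + r * exp (t * tau) * ((f j Q - f j P) / f j P)) with hγ
  refine ⟨γ 0, JoinedIn.ofLine (f := γ) ?_ rfl ?_ ?_⟩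
  · refine continuousOn_pi.2 fun j => ?_
    by_cases hj : j = k
    · simp only [hγ, hj, if_true]
      fun_prop
    · simp only [hγ, hj, if_false]
      exact continuousOn_const.add (ContinuousOn.clog (by fun_prop) fun t _ => hslit j hj t)
  · ext j
    by_cases hj : j = k
    · subst hj; simp [hγ]
    · simp [hγ, hj, exp_tau]
  · rintro _ ⟨t, -, rfl⟩
    refine ⟨AffineMap.lineMap P Q ((r : ℂ) * exp (t * tau)), fun j => ?_⟩
    rw [apply_lineMap_eq]
    by_cases hj : j = k
    · subst hj
      have : (r : ℂ) * f j Q ≠ 0 := mul_ne_zero (ofReal_ne_zero.2 hr0.ne') (hQ j)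
      simp only [hγ, if_true, exp_add, exp_log this, hk]
      ring
    · have := hP j hj
      simp only [hγ, hj, if_false, exp_add, exp_log this, exp_log (slitPlane_ne_zero (hslit j hj t))]
      field_simp

/-- The translations by `2πi` that can be realized by paths from every point form a subgroup `H`. A
loop around the `k`-th hyperplane puts the `k`-th unit vector in `H`, so `H` is everything. Any
point can be moved over `Q`, where only such a translation remains. -/
theorem isPathConnected_logCover [Finite ι] {f : ι → V →ᵃ[ℂ] ℂ} (hne : ∃ Q, ∀ j, f j Q ≠ 0)
    (h : ∀ k, ∃ P, f k P = 0 ∧ ∀ j, j ≠ k → f j P ≠ 0) : IsPathConnected (logCover f) := by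
  classical
  have := Fintype.ofFinite ι
  obtain ⟨Q, hQ⟩ := hne
  let H : AddSubgroup (ι → ℤ) :=
    { carrier := {n | ∀ g ∈ logCover f, JoinedIn (logCover f) g (fun j => g j + n j * tau)}
      zero_mem' := fun g hg => by simpa using JoinedIn.refl hg
      add_mem' := fun {m n} hm hn g hg => by
        have := (hm g hg).trans (hn _ (add_int_mul_tau_mem_logCover hg m))
        simpa [add_mul, add_assoc] using this
      neg_mem' := fun {n} hn g hg => by
        have := (hn _ (add_int_mul_tau_mem_logCover hg (-n))).symm
        simpa using this }
  have hsingle : ∀ k, (Pi.single k 1 : ι → ℤ) ∈ H := by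
    intro k g hg
    obtain ⟨P, hk, hP⟩ := h k
    obtain ⟨g₁, hg₁⟩ := exists_loop hk hP hQ
    obtain ⟨R, hR⟩ := hg₁.source_mem
    obtain ⟨g₂, hg₂, hj⟩ := exists_joinedIn hg (Q := R)
      fun j => by rw [← hR j]; exact exp_ne_zero _
    have hn : ∀ j, ∃ n : ℤ, g₂ j = g₁ j + n * tau := fun j =>
      exp_eq_exp_iff_tau.1 ((hg₂ j).trans (hR j).symm)
    choose n hn using hn
    have hn : g₂ = fun j => g₁ j + n j * tau := funext hn
    -- The loop is translated to start at `g₂`; conjugating it by the path from `g` to `g₂` moves it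
    -- to the given point `g`.
    have h1 := joinedIn_add_int_mul_tau hg₁ n
    rw [← hn] at h1
    have h2 := joinedIn_add_int_mul_tau hj (Pi.single k 1)
    have h3 : (fun j => g₁ j + (Pi.single k 1 : ι → ℤ) j * tau + n j * tau) =
        fun j => g₂ j + (Pi.single k 1 : ι → ℤ) j * tau := by
      rw [hn]; ext j; ring
    rw [h3] at h1
    exact (hj.trans h1).trans h2.symm
  have hall : ∀ n : ι → ℤ, n ∈ H := by
    intro n
    have : n = ∑ k, n k • (Pi.single k 1 : ι → ℤ) := by
      ext j
      simp [Finset.sum_apply, Pi.single_apply]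
    rw [this]
    exact H.sum_mem fun k _ => H.zsmul_mem (hsingle k) _
  refine ⟨fun j => log (f j Q), ⟨Q, fun j => exp_log (hQ j)⟩, fun {g} hg => ?_⟩
  obtain ⟨g₁, hg₁, hj⟩ := exists_joinedIn hg hQ
  have hn : ∀ j, ∃ n : ℤ, g₁ j = log (f j Q) + n * tau := fun j =>
    exp_eq_exp_iff_tau.1 ((hg₁ j).trans (exp_log (hQ j)).symm)
  choose n hn using hn
  have h1 := hall n (fun j => log (f j Q)) ⟨Q, fun j => exp_log (hQ j)⟩
  rw [← (funext hn : g₁ = _)] at h1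
  exact h1.trans hj.symm

end Arrangement

/-! ### The component of the five term relations in logarithmic coordinates -/

/-- The affine functions `x`, `1 - x`, `y`, `1 - y`, `x - y` on `ℂ²`. -/
def fiveForms : Fin 5 → (ℂ × ℂ) →ᵃ[ℂ] ℂ :=
  ![(LinearMap.fst ℂ ℂ ℂ).toAffineMap,
    AffineMap.const ℂ (ℂ × ℂ) (1 : ℂ) - (LinearMap.fst ℂ ℂ ℂ).toAffineMap,
    (LinearMap.snd ℂ ℂ ℂ).toAffineMap,
    AffineMap.const ℂ (ℂ × ℂ) (1 : ℂ) - (LinearMap.snd ℂ ℂ ℂ).toAffineMap,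
    (LinearMap.fst ℂ ℂ ℂ).toAffineMap - (LinearMap.snd ℂ ℂ ℂ).toAffineMap]

theorem fiveForms_apply (P : ℂ × ℂ) (j : Fin 5) :
    fiveForms j P = ![P.1, 1 - P.1, P.2, 1 - P.2, P.1 - P.2] j := by
  fin_cases j <;> simp [fiveForms]

/-- The logarithms of `x`, `1 - x`, `y`, `1 - y`, `x - y` for `x ≠ y` in `ℂ ∖ {0, 1}`. -/
def fiveLogs : Set (Fin 5 → ℂ) := logCover fiveForms

theorem isPathConnected_fiveLogs : IsPathConnected fiveLogs := by
  refine isPathConnected_logCover ⟨(2, 3), fun j => ?_⟩ fun k => ?_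
  · rw [fiveForms_apply]
    fin_cases j <;> norm_num
  · have : ∃ P : ℂ × ℂ, ![P.1, 1 - P.1, P.2, 1 - P.2, P.1 - P.2] k = 0 ∧
        ∀ j, j ≠ k → ![P.1, 1 - P.1, P.2, 1 - P.2, P.1 - P.2] j ≠ 0 := by
      fin_cases k
      · refine ⟨(0, 2), rfl, fun j hj => ?_⟩
        fin_cases j <;> first | exact absurd rfl hj | norm_num
      · refine ⟨(1, 2), by norm_num, fun j hj => ?_⟩
        fin_cases j <;> first | exact absurd rfl hj | norm_num
      · refine ⟨(2, 0), rfl, fun j hj => ?_⟩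
        fin_cases j <;> first | exact absurd rfl hj | norm_num
      · refine ⟨(2, 1), by norm_num, fun j hj => ?_⟩
        fin_cases j <;> first | exact absurd rfl hj | norm_num
      · refine ⟨(2, 2), by norm_num, fun j hj => ?_⟩
        fin_cases j <;> first | exact absurd rfl hj | norm_num
    simpa only [fiveForms_apply] using this

theorem mem_fiveLogs {g : Fin 5 → ℂ} : g ∈ fiveLogs ↔
    exp (g 0) + exp (g 1) = 1 ∧ exp (g 2) + exp (g 3) = 1 ∧ exp (g 4) = exp (g 0) - exp (g 2) := by
  constructor
  · rintro ⟨P, hP⟩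
    have h0 := hP 0
    have h1 := hP 1
    have h2 := hP 2
    have h3 := hP 3
    have h4 := hP 4
    simp only [fiveForms_apply, Matrix.cons_val] at h0 h1 h2 h3 h4
    rw [h0, h1, h2, h3, h4]
    refine ⟨by ring, by ring, rfl⟩
  · rintro ⟨h1, h2, h3⟩
    refine ⟨(exp (g 0), exp (g 2)), fun j => ?_⟩
    rw [fiveForms_apply]
    fin_cases j
    · rfl
    · exact eq_sub_of_add_eq' h1
    · rfl
    · exact eq_sub_of_add_eq' h2
    · exact h3

/-- The logarithmic coordinates of the five entries of a five term relation. -/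
def fiveCoords (g : Fin 5 → ℂ) : Fin 5 → ℂ × ℂ :=
  ![(g 0, g 1), (g 2, g 3), (g 2 - g 0, g 4 - g 0), (g 2 - g 0 + (g 1 - g 3), g 4 - g 0 - g 3),
    (g 1 - g 3, g 4 - g 3)]

theorem exp_fiveCoords {g : Fin 5 → ℂ} (hg : g ∈ fiveLogs) (i : Fin 5) :
    exp (fiveCoords g i).1 + exp (fiveCoords g i).2 = 1 := by
  obtain ⟨h1, h2, h3⟩ := mem_fiveLogs.1 hg
  have e0 := exp_ne_zero (g 0)
  have e3 := exp_ne_zero (g 3)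
  have h1' : exp (g 1) = 1 - exp (g 0) := by rw [← h1]; ring
  have h2' : exp (g 3) = 1 - exp (g 2) := by rw [← h2]; ring
  fin_cases i
  · exact h1
  · exact h2
  · simp only [fiveCoords, Fin.reduceFinMk, Matrix.cons_val, exp_sub, h3]
    field_simp
    ring
  · simp only [fiveCoords, Fin.reduceFinMk, Matrix.cons_val, exp_sub, exp_add, h3]
    field_simp
    rw [h1', h2']
    ring
  · simp only [fiveCoords, Fin.reduceFinMk, Matrix.cons_val, exp_sub, h3]
    field_simp
    rw [h1', h2']
    ring

/-- The lift of a five term relation to the cover. -/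
def fivePoints (g : Fin 5 → ℂ) (i : Fin 5) : Chat := chat (fiveCoords g i)

theorem continuous_fiveCoords (i : Fin 5) : Continuous fun g => fiveCoords g i := by
  fin_cases i <;> simp only [fiveCoords, Fin.reduceFinMk, Matrix.cons_val] <;> fun_prop

theorem continuousOn_fivePoints : ContinuousOn fivePoints fiveLogs :=
  continuousOn_pi.2 fun i => continuousOn_chat.comp (continuous_fiveCoords i).continuousOn
    fun _ hg => exp_fiveCoords hg i

theorem fivePoints_mem_FTpre {g : Fin 5 → ℂ} (hg : g ∈ fiveLogs) : fivePoints g ∈ FTpre := by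
  obtain ⟨h1, h2, h3⟩ := mem_fiveLogs.1 hg
  have hp : ∀ i, (fivePoints g i).proj = exp (fiveCoords g i).1 :=
    fun i => proj_chat (exp_fiveCoords hg i)
  have e0 := exp_ne_zero (g 0)
  have e2 := exp_ne_zero (g 2)
  have e3 := exp_ne_zero (g 3)
  have h1' : exp (g 1) = 1 - exp (g 0) := by rw [← h1]; ring
  have h2' : exp (g 3) = 1 - exp (g 2) := by rw [← h2]; ring
  refine ⟨exp (g 0), exp (g 2), e0, ?_, e2, ?_, ?_, funext fun i => ?_⟩
  · intro h; exact exp_ne_zero (g 1) (by rw [h1', h, sub_self])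
  · intro h; exact e3 (by rw [h2', h, sub_self])
  · intro h; exact exp_ne_zero (g 4) (by rw [h3, h, sub_self])
  · rw [hp]
    rw [h2'] at e3
    have e3' : exp (g 2) - 1 ≠ 0 := fun h => e3 (by linear_combination -h)
    fin_cases i
    · rfl
    · rfl
    · simp [fiveCoords, exp_sub]
    · simp only [fiveCoords, Fin.reduceFinMk, Matrix.cons_val, exp_add, exp_sub, h1', h2']
      field_simp
      ring
    · simp only [fiveCoords, Fin.reduceFinMk, Matrix.cons_val, exp_sub, h1', h2']

/-! ### Linear equations that cut out the component. -/

/-- The linear relations between the logarithmic coordinates of a five term relation, in the form of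
quantities that vanish. -/
def fiveRel (w : Fin 5 → Chat) : Fin 5 → ℂ :=
  ![(w 2).coord.1 - ((w 1).coord.1 - (w 0).coord.1),
    (w 3).coord.1 - ((w 2).coord.1 + (w 4).coord.1),
    (w 4).coord.1 - ((w 0).coord.2 - (w 1).coord.2),
    (w 3).coord.2 - ((w 4).coord.2 - (w 0).coord.1),
    (w 3).coord.2 - ((w 2).coord.2 - (w 1).coord.2)]

theorem continuous_fiveRel (k : Fin 5) : Continuous fun w => fiveRel w k := by
  have h1 : ∀ i : Fin 5, Continuous fun w : Fin 5 → Chat => (w i).coord.1 := fun i =>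
    continuous_fst.comp (Chat.continuous_coord.comp (continuous_apply i))
  have h2 : ∀ i : Fin 5, Continuous fun w : Fin 5 → Chat => (w i).coord.2 := fun i =>
    continuous_snd.comp (Chat.continuous_coord.comp (continuous_apply i))
  fin_cases k <;> simp only [fiveRel, Fin.reduceFinMk, Matrix.cons_val]
  · exact (h1 2).sub ((h1 1).sub (h1 0))
  · exact (h1 3).sub ((h1 2).add (h1 4))
  · exact (h1 4).sub ((h2 0).sub (h2 1))
  · exact (h2 3).sub ((h2 4).sub (h1 0))
  · exact (h2 3).sub ((h2 2).sub (h2 1))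

theorem proj_of_mem_FTpre {w : Fin 5 → Chat} (hw : w ∈ FTpre) : ∃ x y : ℂ,
    x ≠ 0 ∧ x ≠ 1 ∧ y ≠ 0 ∧ y ≠ 1 ∧ x ≠ y ∧ (w 0).proj = x ∧ (w 1).proj = y ∧
      (w 2).proj = y / x ∧ (w 3).proj = (1 - 1 / x) / (1 - 1 / y) ∧
        (w 4).proj = (1 - x) / (1 - y) := by
  obtain ⟨x, y, hx0, hx1, hy0, hy1, hxy, h⟩ := hw
  exact ⟨x, y, hx0, hx1, hy0, hy1, hxy, congrFun h 0, congrFun h 1, congrFun h 2, congrFun h 3,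
    congrFun h 4⟩

theorem exp_fiveRel {w : Fin 5 → Chat} (hw : w ∈ FTpre) (k : Fin 5) : exp (fiveRel w k) = 1 := by
  obtain ⟨x, y, hx0, hx1, hy0, hy1, hxy, h0, h1, h2, h3, h4⟩ := proj_of_mem_FTpre hw
  have hx1' : 1 - x ≠ 0 := sub_ne_zero.2 hx1.symm
  have hy1' : 1 - y ≠ 0 := sub_ne_zero.2 hy1.symm
  have hy1'' : y - 1 ≠ 0 := sub_ne_zero.2 hy1
  have hx1'' : x - 1 ≠ 0 := sub_ne_zero.2 hx1
  have hxy' : x - y ≠ 0 := sub_ne_zero.2 hxy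
  have a3 : (1 - 1 / x) / (1 - 1 / y) = y * (1 - x) / (x * (1 - y)) := by
    have : 1 - 1 / y ≠ 0 := by
      rw [one_sub_div hy0]; exact div_ne_zero hy1'' hy0
    field_simp
    ring
  have b2 : 1 - y / x = (x - y) / x := by field_simp
  have b3 : 1 - y * (1 - x) / (x * (1 - y)) = (x - y) / (x * (1 - y)) := by field_simp; ring
  have b4 : 1 - (1 - x) / (1 - y) = (x - y) / (1 - y) := by field_simp; ring
  rw [a3] at h3
  fin_cases k <;> simp only [fiveRel, Fin.reduceFinMk, Matrix.cons_val, exp_sub, exp_add,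
    Chat.exp_coord_fst, Chat.exp_coord_snd, h0, h1, h2, h3, h4, b2, b3, b4] <;> field_simp

theorem fiveRel_eq_int_mul_tau {w : Fin 5 → Chat} (hw : w ∈ FTpre) (k : Fin 5) :
    ∃ n : ℤ, fiveRel w k = n * tau := by
  have := exp_fiveRel hw k
  rw [← exp_zero] at this
  obtain ⟨n, hn⟩ := exp_eq_exp_iff_tau.1 this
  exact ⟨n, by rw [hn, zero_add]⟩

/-- Divided by `2πi`, the defects are continuous and take integer values. -/
theorem fiveRel_eq_of_isPreconnected {S : Set (Fin 5 → Chat)} (hS : IsPreconnected S)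
    (hST : S ⊆ FTpre) {w w' : Fin 5 → Chat} (hw : w ∈ S) (hw' : w' ∈ S) :
    fiveRel w = fiveRel w' := by
  funext k
  have hint : ∀ a ∈ S, ∃ n : ℤ, fiveRel a k / tau = n := fun a ha => by
    obtain ⟨n, hn⟩ := fiveRel_eq_int_mul_tau (hST ha) k
    exact ⟨n, by rw [hn, mul_div_cancel_right₀ _ tau_ne_zero]⟩
  have h := hS.constant (continuousOn_round_re
    ((continuous_fiveRel k).div_const tau).continuousOn hint) hw hw'
  obtain ⟨n, hn⟩ := hint w hw
  obtain ⟨n', hn'⟩ := hint w' hw'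
  simp only [hn, hn', intCast_re, round_intCast] at h
  rw [h, ← hn'] at hn
  exact (div_left_inj' tau_ne_zero).1 hn

theorem FThatPlus_subset_FTpre : FThatPlus ⊆ FTpre := by
  rintro w ⟨z, hz, h⟩
  have : (fun i => (w i).proj) = z := funext fun i => by
    obtain ⟨-, hc, hw⟩ := h i
    rw [hw]
    rfl
  simpa only [FTpre, mem_ofPred_eq, this] using hz

theorem im_coord_of_mem_FThatPlus {w : Fin 5 → Chat} (hw : w ∈ FThatPlus) (i : Fin 5) :
    0 < (w i).coord.1.im ∧ (w i).coord.1.im < Real.pi ∧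
      -Real.pi < (w i).coord.2.im ∧ (w i).coord.2.im < 0 := by
  obtain ⟨z, -, h⟩ := hw
  obtain ⟨him, hc, hw⟩ := h i
  have h1 : (w i).coord = (log (z i), log (1 - z i)) := by
    rw [hw, Chat.coord_mk]
    simp [CutPlane.coord, CutPlane.log, CutPlane.logOneSub]
  have him' : (1 - z i).im < 0 := by simpa using him
  rw [h1]
  simp only [log_im]
  refine ⟨?_, ?_, neg_pi_lt_arg _, arg_neg_iff.2 him'⟩
  · refine lt_of_le_of_ne (arg_nonneg_iff.2 him.le) fun h => ?_
    exact him.ne' (arg_eq_zero_iff.1 h.symm).2.symm.symm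
  · exact arg_lt_pi_iff.2 (Or.inr him.ne')

/-- For points in the upper half plane the imaginary parts of `u` and `v` lie in `(0, π)` and `(-π,
0)`. Each defect has three terms whose signs do not let them add up to `±2π`, so the multiple of
`2πi` is zero. -/
theorem fiveRel_eq_zero_of_mem_FThatPlus {w : Fin 5 → Chat} (hw : w ∈ FThatPlus) :
    fiveRel w = 0 := by
  funext k
  obtain ⟨n, hn⟩ := fiveRel_eq_int_mul_tau (FThatPlus_subset_FTpre hw) k
  have hpi := Real.pi_pos
  have him : (fiveRel w k).im = n * (2 * Real.pi) := by
    rw [hn, tau, ← ofReal_ofNat, ← ofReal_mul, ← ofReal_intCast, ← mul_assoc, ← ofReal_mul]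
    simp
  have hbound : |(fiveRel w k).im| < 2 * Real.pi := by
    have h := im_coord_of_mem_FThatPlus hw
    have h0 := h 0
    have h1 := h 1
    have h2 := h 2
    have h3 := h 3
    have h4 := h 4
    rw [abs_lt]
    fin_cases k <;> simp only [fiveRel, Fin.reduceFinMk, Matrix.cons_val, sub_im, add_im] <;>
      constructor <;> linarith
  have hn0 : n = 0 := by
    rw [him, abs_mul, abs_of_pos (by positivity : 0 < 2 * Real.pi)] at hbound
    have : |(n : ℝ)| < 1 := by
      by_contra hc
      nlinarith
    exact Int.abs_lt_one_iff.1 (by exact_mod_cast this)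
  rw [hn, hn0]
  simp

theorem exists_fivePoints_eq {w : Fin 5 → Chat} (hw : w ∈ FTpre) (h : fiveRel w = 0) :
    ∃ g ∈ fiveLogs, fivePoints g = w := by
  obtain ⟨x, y, hx0, hx1, hy0, hy1, hxy, h0, h1, h2, h3, h4⟩ := proj_of_mem_FTpre hw
  refine ⟨![(w 0).coord.1, (w 0).coord.2, (w 1).coord.1, (w 1).coord.2,
    (w 2).coord.2 + (w 0).coord.1], ?_, funext fun i => ?_⟩
  · rw [mem_fiveLogs]
    simp only [Matrix.cons_val, exp_add, Chat.exp_coord_fst, Chat.exp_coord_snd, h0, h1, h2]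
    refine ⟨by ring, by ring, ?_⟩
    field_simp
  · have r0 : (w 2).coord.1 - ((w 1).coord.1 - (w 0).coord.1) = 0 := congrFun h 0
    have r1 : (w 3).coord.1 - ((w 2).coord.1 + (w 4).coord.1) = 0 := congrFun h 1
    have r2 : (w 4).coord.1 - ((w 0).coord.2 - (w 1).coord.2) = 0 := congrFun h 2
    have r3 : (w 3).coord.2 - ((w 4).coord.2 - (w 0).coord.1) = 0 := congrFun h 3
    have r4 : (w 3).coord.2 - ((w 2).coord.2 - (w 1).coord.2) = 0 := congrFun h 4
    rw [fivePoints, ← chat_coord (w i)]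
    congr 1
    fin_cases i <;> simp only [fiveCoords, Fin.reduceFinMk, Matrix.cons_val] <;> ext1 <;> simp only
    · linear_combination -r0
    · ring
    · linear_combination -r0 - r1 - r2
    · linear_combination -r4
    · linear_combination -r2
    · linear_combination r3 - r4

theorem FThatPlus_nonempty : FThatPlus.Nonempty := by
  -- Any `x`, `y` making all five entries lie in the upper half plane would do; here the other three
  -- are `27/10 + 9i/10`, `9/10 + 3i/5` and `11/30 + i/10`.
  set x : ℂ := ⟨1 / 3, 1⟩ with hx
  set y : ℂ := ⟨0, 3⟩ with hy
  have hx0 : x ≠ 0 := fun h => by simpa [hx] using congrArg Complex.im h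
  have hx1 : x ≠ 1 := fun h => by simpa [hx] using congrArg Complex.im h
  have hy0 : y ≠ 0 := fun h => by simpa [hy] using congrArg Complex.im h
  have hy1 : y ≠ 1 := fun h => by simpa [hy] using congrArg Complex.im h
  have hxy : x ≠ y := fun h => by simpa [hx, hy] using congrArg Complex.re h
  have hy1' : 1 - y ≠ 0 := sub_ne_zero.2 hy1.symm
  have hy1'' : y - 1 ≠ 0 := sub_ne_zero.2 hy1
  have h2 : y / x = ⟨27 / 10, 9 / 10⟩ := by
    rw [div_eq_iff hx0]
    apply Complex.ext <;> simp [hx, hy] <;> norm_num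
  have h4 : (1 - x) / (1 - y) = ⟨11 / 30, 1 / 10⟩ := by
    rw [div_eq_iff hy1']
    apply Complex.ext <;> simp [hx, hy] <;> norm_num
  have h3 : (1 - 1 / x) / (1 - 1 / y) = ⟨9 / 10, 3 / 5⟩ := by
    have : (1 - 1 / x) / (1 - 1 / y) = (y / x) * ((1 - x) / (1 - y)) := by
      have : 1 - 1 / y ≠ 0 := by
        rw [one_sub_div hy0]; exact div_ne_zero hy1'' hy0
      field_simp
      ring
    rw [this, h2, h4]
    apply Complex.ext <;> simp <;> norm_num
  set z : Fin 5 → ℂ := ![x, y, y / x, (1 - 1 / x) / (1 - 1 / y), (1 - x) / (1 - y)] with hz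
  have him : ∀ i, 0 < (z i).im := by
    intro i
    fin_cases i
    · simp [hz, hx]
    · simp [hz, hy]
    · simp [hz, h2]
    · simp only [hz, Fin.reduceFinMk, Matrix.cons_val, h3]; norm_num
    · simp only [hz, Fin.reduceFinMk, Matrix.cons_val, h4]; norm_num
  have hc : ∀ i, z i ∈ cutDomain := fun i h => (him i).ne' h.1
  exact ⟨fun i => Chat.mk (.inner (z i) (hc i)) 0 0, z, ⟨x, y, hx0, hx1, hy0, hy1, hxy, rfl⟩,
    fun i => ⟨him i, hc i, rfl⟩⟩

/-- The component of the five term relations consists of the points satisfying the linear relations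
between logarithms. -/
theorem FThat_eq_image : FThat = fivePoints '' fiveLogs := by
  ext w
  constructor
  · rintro ⟨w₀, h₀, hw⟩
    have hmem := FThatPlus_subset_FTpre h₀
    have hrel : fiveRel w = 0 := by
      rw [← fiveRel_eq_zero_of_mem_FThatPlus h₀]
      exact fiveRel_eq_of_isPreconnected isPreconnected_connectedComponentIn
        (connectedComponentIn_subset _ _) hw (mem_connectedComponentIn hmem)
    exact exists_fivePoints_eq (connectedComponentIn_subset _ _ hw) hrel
  · rintro ⟨g, hg, rfl⟩
    obtain ⟨w₀, h₀⟩ := FThatPlus_nonempty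
    obtain ⟨g₀, hg₀, hw₀⟩ := exists_fivePoints_eq (FThatPlus_subset_FTpre h₀)
      (fiveRel_eq_zero_of_mem_FThatPlus h₀)
    refine ⟨w₀, h₀, ?_⟩
    refine (isPathConnected_fiveLogs.isConnected.isPreconnected.image _
      continuousOn_fivePoints).subset_connectedComponentIn ⟨g₀, hg₀, hw₀⟩ ?_ ⟨g, hg, rfl⟩
    rintro _ ⟨g, hg, rfl⟩
    exact fivePoints_mem_FTpre hg

/-! ### The five term relation for the extended Rogers dilogarithm -/

/-- `φ` is a primitive of `(u dv - v du) / 2` along curves in `{e ^ u + e ^ v = 1}` through `w`. -/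
def IsRogersPrimitiveAt (φ : ℂ × ℂ → ℂ) (w : ℂ × ℂ) : Prop :=
  ∀ (u v : ℝ → ℂ) (u' v' : ℂ) (s : ℝ), (u s, v s) = w → HasDerivAt u u' s → HasDerivAt v v' s →
    exp (u s) + exp (v s) = 1 → exp (u s) * u' + exp (v s) * v' = 0 →
      HasDerivAt (fun t => φ (u t, v t)) ((u s * v' - v s * u') / 2) s

theorem isRogersPrimitiveAt_rogersLeft {w : ℂ × ℂ} (hw : exp w.2 ∈ slitPlane) :
    IsRogersPrimitiveAt rogersLeft w := by
  rintro u v u' v' s rfl hu hv h h'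
  exact hasDerivAt_rogersLeft hu hv h h' hw

theorem isRogersPrimitiveAt_rogersRight {w : ℂ × ℂ} (hw : exp w.1 ∈ slitPlane) :
    IsRogersPrimitiveAt rogersRight w := by
  rintro u v u' v' s rfl hu hv h h'
  exact hasDerivAt_rogersRight hu hv h h' hw

/-- The alternating sum of five elements of an abelian group. -/
def altSum {A : Type*} [AddCommGroup A] (a : Fin 5 → A) : A := a 0 - a 1 + a 2 - a 3 + a 4

/-- This is the identity `∑ (-1)ⁱ uᵢ ∧ vᵢ = 0` for the five coordinate pairs, which are linear in
the five logarithms. -/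
theorem hasDerivAt_altSum {φ : Fin 5 → ℂ × ℂ → ℂ} {γ : ℝ → Fin 5 → ℂ} {d : Fin 5 → ℂ} {s : ℝ}
    (hγ : ∀ j, HasDerivAt (fun t => γ t j) (d j) s) (hmem : ∀ᶠ t in 𝓝 s, γ t ∈ fiveLogs)
    (hφ : ∀ i, IsRogersPrimitiveAt (φ i) (fiveCoords (γ s) i)) :
    HasDerivAt (fun t => altSum fun i => φ i (fiveCoords (γ t) i)) 0 s := by
  have hu : ∀ i, HasDerivAt (fun t => (fiveCoords (γ t) i).1)
      (![d 0, d 2, d 2 - d 0, d 2 - d 0 + (d 1 - d 3), d 1 - d 3] i) s := by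
    intro i
    fin_cases i <;> simp only [fiveCoords, Fin.reduceFinMk, Matrix.cons_val]
    · exact hγ 0
    · exact hγ 2
    · exact (hγ 2).sub (hγ 0)
    · exact ((hγ 2).sub (hγ 0)).add ((hγ 1).sub (hγ 3))
    · exact (hγ 1).sub (hγ 3)
  have hv : ∀ i, HasDerivAt (fun t => (fiveCoords (γ t) i).2)
      (![d 1, d 3, d 4 - d 0, d 4 - d 0 - d 3, d 4 - d 3] i) s := by
    intro i
    fin_cases i <;> simp only [fiveCoords, Fin.reduceFinMk, Matrix.cons_val]
    · exact hγ 1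
    · exact hγ 3
    · exact (hγ 4).sub (hγ 0)
    · exact ((hγ 4).sub (hγ 0)).sub (hγ 3)
    · exact (hγ 4).sub (hγ 3)
  have hdiff : ∀ i, HasDerivAt (fun t => φ i (fiveCoords (γ t) i))
      (((fiveCoords (γ s) i).1 * ![d 1, d 3, d 4 - d 0, d 4 - d 0 - d 3, d 4 - d 3] i -
        (fiveCoords (γ s) i).2 *
          ![d 0, d 2, d 2 - d 0, d 2 - d 0 + (d 1 - d 3), d 1 - d 3] i) / 2) s := fun i =>
    hφ i _ _ _ _ s rfl (hu i) (hv i) (exp_fiveCoords hmem.self_of_nhds i) (by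
      refine ((hu i).cexp.add (hv i).cexp).unique ((hasDerivAt_const s (1 : ℂ)).congr_of_eventuallyEq ?_)
      filter_upwards [hmem] with t ht using exp_fiveCoords ht i)
  refine (((((hdiff 0).sub (hdiff 1)).add (hdiff 2)).sub (hdiff 3)).add (hdiff 4)).congr_deriv ?_
  simp only [fiveCoords, Matrix.cons_val]
  ring

/-- If `e ^ u` is off the slit plane its real part is at most `0`, so `e ^ v = 1 - e ^ u` is in it:
at least one of the two charts is always available. -/
theorem exists_local_primitive {w : ℂ × ℂ} (hw : exp w.1 + exp w.2 = 1) :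
    ∃ φ, ∀ᶠ w' in 𝓝 w, IsRogersPrimitiveAt φ w' ∧
      (exp w'.1 + exp w'.2 = 1 → (chat w').lhat = (φ w' : ℂ)) := by
  by_cases h : exp w.1 ∈ slitPlane
  · refine ⟨rogersRight, ?_⟩
    have hopen : IsOpen {w : ℂ × ℂ | exp w.1 ∈ slitPlane} := isOpen_slitPlane.preimage (by fun_prop)
    filter_upwards [hopen.mem_nhds h] with w' hw'
    refine ⟨isRogersPrimitiveAt_rogersRight hw', fun h1 => ?_⟩
    rw [Chat.lhat_eq_rogersRight _ (by rw [proj_chat h1]; exact hw'), coord_chat h1]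
  · refine ⟨rogersLeft, ?_⟩
    have hopen : IsOpen {w : ℂ × ℂ | exp w.2 ∈ slitPlane} := isOpen_slitPlane.preimage (by fun_prop)
    have h2 : exp w.2 ∈ slitPlane := by
      have hw2 : exp w.2 = 1 - exp w.1 := by rw [← hw]; ring
      simp only [mem_slitPlane_iff, not_or, not_lt, ne_eq, not_not] at h
      rw [hw2, mem_slitPlane_iff]
      left
      rw [sub_re, one_re]
      linarith [h.1]
    filter_upwards [hopen.mem_nhds h2] with w' hw'
    refine ⟨isRogersPrimitiveAt_rogersLeft hw', fun h1 => ?_⟩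
    have hw2 : exp w'.2 = 1 - exp w'.1 := by rw [← h1]; ring
    have hw'' : exp w'.2 ∈ slitPlane := hw'
    rw [Chat.lhat_eq_rogersLeft _ (by rw [proj_chat h1, ← hw2]; exact hw''), coord_chat h1]

/-- The alternating sum of the extended Rogers dilogarithm over a lifted five term relation. -/
def fiveSum (g : Fin 5 → ℂ) : ℂ ⧸ Z2 := altSum fun i => (fivePoints g i).lhat

theorem altSum_coe (a : Fin 5 → ℂ) :
    altSum (fun i => ((a i : ℂ) : ℂ ⧸ Z2)) = ((altSum a : ℂ) : ℂ ⧸ Z2) := rfl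

/-- A nearby point is joined to `g₀` by lifting the segment between the underlying points `(x, y)`.
Along it the five values are given by fixed local primitives, whose alternating sum has derivative
zero. -/
theorem eventually_fiveSum_eq {g₀ : Fin 5 → ℂ} (h₀ : g₀ ∈ fiveLogs) :
    ∀ᶠ g in 𝓝 g₀, g ∈ fiveLogs → fiveSum g = fiveSum g₀ := by
  choose φ hφ using fun i => exists_local_primitive (exp_fiveCoords h₀ i)
  have hφ' : ∀ᶠ g in 𝓝 g₀, ∀ i, IsRogersPrimitiveAt (φ i) (fiveCoords g i) ∧
      (exp (fiveCoords g i).1 + exp (fiveCoords g i).2 = 1 →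
        (fivePoints g i).lhat = (φ i (fiveCoords g i) : ℂ)) :=
    eventually_all.2 fun i => ((continuous_fiveCoords i).tendsto g₀).eventually (hφ i)
  obtain ⟨ε, hε, hball⟩ := Metric.eventually_nhds_iff.1 hφ'
  have hsum : ∀ g ∈ fiveLogs, dist g g₀ < ε →
      fiveSum g = (altSum (fun i => φ i (fiveCoords g i)) : ℂ) := by
    intro g hg hd
    rw [← altSum_coe, fiveSum]
    congr 1
    exact funext fun i => (hball hd i).2 (exp_fiveCoords hg i)
  have hlog : ∀ᶠ w : ℂ in 𝓝 1, w ∈ slitPlane ∧ ‖log w‖ < ε := by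
    have h1 : Tendsto (fun w : ℂ => ‖log w‖) (𝓝 1) (𝓝 0) := by
      simpa using (continuousAt_clog one_mem_slitPlane).norm.tendsto
    exact (isOpen_slitPlane.eventually_mem one_mem_slitPlane).and (h1.eventually_lt_const hε)
  obtain ⟨δ, hδ, hlog⟩ := Metric.eventually_nhds_iff.1 hlog
  -- The factor `2` gives room for parameters in `(-2, 2)`, so that two-sided derivatives exist on
  -- `[0, 1]`. The second condition makes the lifted segment end at `g` and not at a translate.
  have hratio : ∀ᶠ g in 𝓝 g₀, ∀ j, ‖exp (g j - g₀ j) - 1‖ * 2 < δ ∧ log (exp (g j - g₀ j)) = g j - g₀ j := by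
    refine eventually_all.2 fun j => ?_
    have h1 : Continuous fun g : Fin 5 → ℂ => ‖exp (g j - g₀ j) - 1‖ * 2 := by fun_prop
    have h2 : Continuous fun g : Fin 5 → ℂ => |(g j - g₀ j).im| := by fun_prop
    have h1 := h1.tendsto g₀
    have h2 := h2.tendsto g₀
    simp only [sub_self, exp_zero, norm_zero, zero_mul, zero_im, abs_zero] at h1 h2
    filter_upwards [h1.eventually_lt_const hδ, h2.eventually_lt_const Real.pi_pos] with g hg1 hg2
    rw [abs_lt] at hg2
    exact ⟨hg1, log_exp hg2.1 hg2.2.le⟩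
  filter_upwards [hratio] with g hr hg
  set r : Fin 5 → ℂ := fun j => exp (g j - g₀ j) with hrdef
  set γ : ℝ → Fin 5 → ℂ := fun t j => g₀ j + log (1 + t * (r j - 1)) with hγ
  have hnear : ∀ t ∈ Ioo (-2 : ℝ) 2, ∀ j, 1 + (t : ℂ) * (r j - 1) ∈ slitPlane ∧
      ‖log (1 + (t : ℂ) * (r j - 1))‖ < ε := by
    intro t ht j
    apply hlog
    rw [dist_eq_norm, add_sub_cancel_left, norm_mul, norm_real, Real.norm_eq_abs]
    have := abs_lt.2 ht
    nlinarith [(hr j).1, norm_nonneg (r j - 1), abs_nonneg t]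
  obtain ⟨P₀, hP₀⟩ := h₀
  obtain ⟨P, hP⟩ := hg
  have hmem : ∀ t ∈ Ioo (-2 : ℝ) 2, γ t ∈ fiveLogs := by
    intro t ht
    refine ⟨AffineMap.lineMap P₀ P (t : ℂ), fun j => ?_⟩
    have hne : exp (g₀ j) ≠ 0 := exp_ne_zero _
    rw [apply_lineMap_eq, hγ, exp_add, exp_log (slitPlane_ne_zero (hnear t ht j).1), ← hP₀, ← hP,
      hrdef]
    simp only [exp_sub]
    field_simp
  have hdist : ∀ t ∈ Ioo (-2 : ℝ) 2, dist (γ t) g₀ < ε := by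
    intro t ht
    refine (dist_pi_lt_iff hε).2 fun j => ?_
    rw [dist_eq_norm]
    simpa [hγ] using (hnear t ht j).2
  have hderiv : ∀ t ∈ Ioo (-2 : ℝ) 2,
      HasDerivAt (fun t => altSum fun i => φ i (fiveCoords (γ t) i)) 0 t := by
    intro t ht
    refine hasDerivAt_altSum (d := fun j => (r j - 1) / (1 + (t : ℂ) * (r j - 1))) (fun j => ?_) ?_
      fun i => (hball (hdist t ht) i).1
    · have h1 : HasDerivAt (fun t : ℝ => 1 + (t : ℂ) * (r j - 1)) (r j - 1) t := by
        simpa using ((ofRealCLM.hasDerivAt (x := t)).mul_const (r j - 1)).const_add 1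
      exact (h1.clog_real (hnear t ht j).1).const_add _
    · filter_upwards [Ioo_mem_nhds ht.1 ht.2] with s hs using hmem s hs
  have hsub : ∀ t ∈ Icc (0 : ℝ) 1, t ∈ Ioo (-2 : ℝ) 2 := fun t ht =>
    ⟨by linarith [ht.1], by linarith [ht.2]⟩
  have hconst : altSum (fun i => φ i (fiveCoords (γ 1) i)) =
      altSum (fun i => φ i (fiveCoords (γ 0) i)) := constant_of_has_deriv_right_zero (a := 0) (b := 1)
    (f := fun t => altSum fun i => φ i (fiveCoords (γ t) i))
    (fun t ht => (hderiv t (hsub t ht)).continuousAt.continuousWithinAt)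
    (fun t ht => (hderiv t (hsub t ⟨ht.1, ht.2.le⟩)).hasDerivWithinAt) 1 ⟨zero_le_one, le_rfl⟩
  have hγ0 : γ 0 = g₀ := by ext j; simp [hγ]
  have hγ1 : γ 1 = g := by
    ext j
    have := (hr j).2
    simp only [hγ, ofReal_one, one_mul, add_sub_cancel, hrdef, this]
  have h0 := hsum (γ 0) (hmem 0 (by norm_num)) (hdist 0 (by norm_num))
  have h1 := hsum (γ 1) (hmem 1 (by norm_num)) (hdist 1 (by norm_num))
  rw [hconst, ← h0, hγ0, hγ1] at h1
  exact h1

/-- The Rogers dilogarithm on the real line. -/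
def realRogers (x : ℝ) : ℂ := dilogIntegral x + log x * log (1 - x) / 2 - (Real.pi : ℂ) ^ 2 / 6

theorem realRogers_one : realRogers 1 = 0 := by simp [realRogers, dilogIntegral_one]

theorem continuousOn_realRogers : ContinuousOn realRogers (Ioi 0) :=
  (continuous_dilogIntegral_ofReal.continuousOn.add
    (continuousOn_log_mul_log_one_sub.div_const 2)).sub continuousOn_const

theorem rogersLeft_ofReal_log {x : ℝ} (h0 : 0 < x) (h1 : x < 1) :
    rogersLeft ((Real.log x : ℂ), (Real.log (1 - x) : ℂ)) = realRogers x := by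
  have e : (Real.log (1 - x) : ℂ) = log (1 - x) := by
    rw [ofReal_log (by linarith)]; push_cast; rfl
  have e0 : exp (log (x : ℂ)) = x := exp_log (ofReal_ne_zero.2 h0.ne')
  rw [rogersLeft, e, ofReal_log h0.le]
  simp only [e0, realRogers]
  ring

/-- The real logarithms of `x`, `1 - x`, `y`, `1 - y`, `x - y` for `x = 1 / 2`. -/
def realLogs (y : ℝ) : Fin 5 → ℂ := fun j =>
  (Real.log (![1 / 2, 1 / 2, y, 1 - y, 1 / 2 - y] j) : ℂ)

theorem realLogs_mem {y : ℝ} (h0 : 0 < y) (h1 : y < 1 / 2) : realLogs y ∈ fiveLogs := by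
  have he : ∀ x : ℝ, 0 < x → exp (Real.log x : ℂ) = x := fun x hx => by
    rw [← ofReal_exp, Real.exp_log hx]
  rw [mem_fiveLogs]
  simp only [realLogs, Matrix.cons_val]
  rw [he _ (by norm_num), he y h0, he _ (by linarith), he _ (by linarith)]
  refine ⟨?_, ?_, ?_⟩ <;> push_cast <;> ring

theorem fiveCoords_realLogs {y : ℝ} (h0 : 0 < y) (h1 : y < 1 / 2) (i : Fin 5) :
    ∃ x : ℝ, x = ![1 / 2, y, 2 * y, y / (1 - y), 1 / (2 * (1 - y))] i ∧ 0 < x ∧ x < 1 ∧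
      fiveCoords (realLogs y) i = ((Real.log x : ℂ), (Real.log (1 - x) : ℂ)) := by
  have hy1 : 0 < 1 - y := by linarith
  have hxy : 0 < 1 / 2 - y := by linarith
  have l2 : Real.log (1 / 2) = -Real.log 2 := by rw [one_div, Real.log_inv]
  have l3 : Real.log (1 - 2 * y) = Real.log (1 / 2 - y) - Real.log (1 / 2) := by
    rw [← Real.log_div hxy.ne' (by norm_num)]; congr 1; ring
  refine ⟨_, rfl, ?_⟩
  fin_cases i <;> simp only [fiveCoords, realLogs, Fin.reduceFinMk, Matrix.cons_val]
  · norm_num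
  · exact ⟨h0, by linarith, trivial⟩
  · refine ⟨by linarith, by linarith, ?_⟩
    rw [l3, Real.log_mul two_ne_zero h0.ne', l2]
    push_cast
    congr 1
    ring
  · refine ⟨by positivity, by rw [div_lt_one hy1]; linarith, ?_⟩
    have : 1 - y / (1 - y) = (1 - 2 * y) / (1 - y) := by field_simp; ring
    rw [this, Real.log_div h0.ne' hy1.ne', Real.log_div (x := 1 - 2 * y) (by linarith) hy1.ne', l3]
    push_cast
    congr 1
    ring
  · refine ⟨by positivity, by rw [div_lt_one (by positivity)]; linarith, ?_⟩
    have : 1 - 1 / (2 * (1 - y)) = (1 / 2 - y) / (1 - y) := by field_simp; ring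
    rw [this, Real.log_div hxy.ne' hy1.ne', ← div_div, Real.log_div (by norm_num) hy1.ne']
    push_cast
    rfl

theorem rogersLeft_fiveCoords_realLogs {y : ℝ} (h0 : 0 < y) (h1 : y < 1 / 2) (i : Fin 5) :
    rogersLeft (fiveCoords (realLogs y) i) =
      realRogers (![1 / 2, y, 2 * y, y / (1 - y), 1 / (2 * (1 - y))] i) := by
  obtain ⟨x, hx, hx0, hx1, h⟩ := fiveCoords_realLogs h0 h1 i
  rw [h, rogersLeft_ofReal_log hx0 hx1, hx]

theorem exp_fiveCoords_realLogs {y : ℝ} (h0 : 0 < y) (h1 : y < 1 / 2) (i : Fin 5) :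
    exp (fiveCoords (realLogs y) i).2 ∈ slitPlane := by
  obtain ⟨x, hx, hx0, hx1, h⟩ := fiveCoords_realLogs h0 h1 i
  rw [h, ← ofReal_exp, Real.exp_log (by linarith)]
  exact ofReal_mem_slitPlane.2 (by linarith)

/-- With `x = 1 / 2` and `y` increasing to `1 / 2` the sum is constant and continuous up to the end.
There the entries are `1/2, 1/2, 1, 1, 1`: the first two terms cancel and the value at `1` is zero.
-/
theorem altSum_realRogers :
    altSum (fun i => realRogers (![1 / 2, 1 / 4, 2 * (1 / 4), 1 / 4 / (1 - 1 / 4),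
      1 / (2 * (1 - 1 / 4))] i)) = 0 := by
  set k : ℝ → ℂ := fun y =>
    altSum fun i => realRogers (![1 / 2, y, 2 * y, y / (1 - y), 1 / (2 * (1 - y))] i) with hk
  have hcont : ContinuousOn k (Icc (1 / 4) (1 / 2)) := by
    have hc : ∀ f : ℝ → ℝ, ContinuousOn f (Icc (1 / 4) (1 / 2)) →
        (∀ y ∈ Icc (1 / 4 : ℝ) (1 / 2), 0 < f y) →
        ContinuousOn (fun y => realRogers (f y)) (Icc (1 / 4) (1 / 2)) := fun f hf hpos =>
      continuousOn_realRogers.comp hf hpos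
    have hne : ∀ y ∈ Icc (1 / 4 : ℝ) (1 / 2), 0 < 1 - y := fun y hy => by linarith [hy.2]
    have hpos : ∀ y ∈ Icc (1 / 4 : ℝ) (1 / 2), 0 < y := fun y hy => by linarith [hy.1]
    refine ((((hc (fun _ => 1 / 2) (by fun_prop) (by simp)).sub
      (hc (fun y => y) (by fun_prop) hpos)).add
      (hc (fun y => 2 * y) (by fun_prop) fun y hy => by linarith [hpos y hy])).sub
      (hc (fun y => y / (1 - y)) ?_ fun y hy => div_pos (hpos y hy) (hne y hy))).add
      (hc (fun y => 1 / (2 * (1 - y))) ?_ fun y hy => by have := hne y hy; positivity)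
    · exact ContinuousOn.div (by fun_prop) (by fun_prop) fun y hy => (hne y hy).ne'
    · exact ContinuousOn.div (by fun_prop) (by fun_prop) fun y hy => by
        have := hne y hy; positivity
  have hderiv : ∀ y ∈ Ico (1 / 4 : ℝ) (1 / 2), HasDerivAt k 0 y := by
    intro y hy
    have hnhds : ∀ᶠ t in 𝓝 y, t ∈ Ioo (0 : ℝ) (1 / 2) :=
      Ioo_mem_nhds (by linarith [hy.1]) hy.2
    have h0 : 0 < y := by linarith [hy.1]
    have := hasDerivAt_altSum (φ := fun _ => rogersLeft) (γ := realLogs) (s := y)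
      (d := ![0, 0, ((1 / y : ℝ) : ℂ), ((-1 / (1 - y) : ℝ) : ℂ), ((-1 / (1 / 2 - y) : ℝ) : ℂ)])
      (fun j => by
        fin_cases j <;> simp only [realLogs, Fin.reduceFinMk, Matrix.cons_val]
        · exact hasDerivAt_const _ _
        · exact hasDerivAt_const _ _
        · exact ((hasDerivAt_id y).log h0.ne').ofReal_comp
        · exact (((hasDerivAt_id y).const_sub 1).log (by simp; linarith [hy.2])).ofReal_comp
        · exact (((hasDerivAt_id y).const_sub (1 / 2)).log (by simp; linarith [hy.2])).ofReal_comp)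
      (by filter_upwards [hnhds] with t ht using realLogs_mem ht.1 ht.2)
      fun i => isRogersPrimitiveAt_rogersLeft (exp_fiveCoords_realLogs h0 hy.2 i)
    refine this.congr_of_eventuallyEq ?_
    filter_upwards [hnhds] with t ht
    exact congrArg altSum (funext fun i => (rogersLeft_fiveCoords_realLogs ht.1 ht.2 i).symm)
  have hconst := constant_of_has_deriv_right_zero hcont
    (fun y hy => (hderiv y hy).hasDerivWithinAt) (1 / 2) ⟨by norm_num, le_rfl⟩
  refine hconst.symm.trans ?_
  simp only [hk, altSum, Matrix.cons_val]
  norm_num [realRogers_one]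

/-- A locally constant function on a connected space is determined by one value, here at the real
point `x = 1 / 2`, `y = 1 / 4`. -/
theorem fiveSum_eq_zero {g : Fin 5 → ℂ} (hg : g ∈ fiveLogs) : fiveSum g = 0 := by
  have hpre : PreconnectedSpace fiveLogs :=
    Subtype.preconnectedSpace isPathConnected_fiveLogs.isConnected.isPreconnected
  have hloc : IsLocallyConstant fun g : fiveLogs => fiveSum g := by
    rw [IsLocallyConstant.iff_eventually_eq]
    intro g₀
    filter_upwards [(continuous_subtype_val.tendsto g₀).eventually (eventually_fiveSum_eq g₀.2)]
      with g h using h g.2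
  have h0 : (0 : ℝ) < 1 / 4 := by norm_num
  have h1 : (1 / 4 : ℝ) < 1 / 2 := by norm_num
  have hbase := realLogs_mem h0 h1
  have heq : fiveSum g = fiveSum (realLogs (1 / 4)) :=
    hloc.apply_eq_of_preconnectedSpace ⟨g, hg⟩ ⟨_, hbase⟩
  have hval : fiveSum (realLogs (1 / 4)) =
      (altSum (fun i => rogersLeft (fiveCoords (realLogs (1 / 4)) i)) : ℂ) := by
    rw [← altSum_coe, fiveSum]
    congr 1
    funext i
    have hE := exp_fiveCoords hbase i
    have h2 : exp (fiveCoords (realLogs (1 / 4)) i).2 =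
        1 - exp (fiveCoords (realLogs (1 / 4)) i).1 := by rw [← hE]; ring
    rw [fivePoints, Chat.lhat_eq_rogersLeft _ ?_, coord_chat hE]
    rw [proj_chat hE, ← h2]
    exact exp_fiveCoords_realLogs h0 h1 i
  rw [heq, hval]
  simp only [rogersLeft_fiveCoords_realLogs h0 h1]
  rw [altSum_realRogers]
  rfl

/-! ### Relations in the extended pre-Bloch group -/

/-- The class in the extended pre-Bloch group of the point with given logarithmic coordinates. -/
def logSym (u v : ℂ) : PreBloch := QuotientAddGroup.mk (FreeAbelianGroup.of (chat (u, v)))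

theorem sym_eq_logSym (z : CutPlane) (p q : ℤ) :
    sym z p q = logSym (z.log + p * tau) (z.logOneSub - q * tau) := by
  have : chat (z.log + p * tau, z.logOneSub - q * tau) = Chat.mk z p q := chat_coord (Chat.mk z p q)
  rw [logSym, this, sym]

theorem rhohat_of (w : FThat) : rhohat (FreeAbelianGroup.of w) =
    altSum fun i => FreeAbelianGroup.of (w.1 i) := by
  simp [rhohat, altSum]

/-- The form in which the component is used: no branch conditions remain, so each logarithm may be
shifted freely by `2πi`. -/
theorem five_term {a b c d e : ℂ} (h1 : exp a + exp b = 1) (h2 : exp c + exp d = 1)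
    (h3 : exp e = exp a - exp c) :
    logSym a b - logSym c d + logSym (c - a) (e - a) - logSym (c - a + (b - d)) (e - a - d)
      + logSym (b - d) (e - d) = 0 := by
  have hg : ![a, b, c, d, e] ∈ fiveLogs := mem_fiveLogs.2 ⟨h1, h2, h3⟩
  have hw : fivePoints ![a, b, c, d, e] ∈ FThat := by
    rw [FThat_eq_image]; exact ⟨_, hg, rfl⟩
  have := (QuotientAddGroup.eq_zero_iff (N := rhohat.range) _).2 ⟨.of ⟨_, hw⟩, rhohat_of ⟨_, hw⟩⟩
  exact this

/-- The class `{z; 2p}` in logarithmic coordinates. -/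
def logBrace (u v : ℂ) : PreBloch := logSym u v - logSym u (v + tau)

theorem exp_add_tau (a : ℂ) : exp (a + tau) = exp a := by rw [exp_add, exp_tau, mul_one]

theorem exp_sub_tau (a : ℂ) : exp (a - tau) = exp a := by rw [exp_sub, exp_tau, div_one]

theorem brace_eq_logBrace (z : CutPlane) (p q : ℤ) :
    brace z p q = logBrace (z.log + p * tau) (z.logOneSub - q * tau) := by
  rw [brace, logBrace, sym_eq_logSym, sym_eq_logSym]
  congr 2
  push_cast
  ring

/-- Shifting `e` by `2πi` changes only the second coordinates of the last three terms; the
difference of the two relations is the claim. -/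
theorem logBrace_relation {a b c d e : ℂ} (h1 : exp a + exp b = 1) (h2 : exp c + exp d = 1)
    (h3 : exp e = exp a - exp c) :
    logBrace (c - a) (e - a) - logBrace (c - a + (b - d)) (e - a - d) + logBrace (b - d) (e - d) =
      0 := by
  have e1 := five_term h1 h2 h3
  have e2 := five_term h1 h2 ((exp_add_tau e).trans h3)
  rw [show e + tau - a = e - a + tau by ring, show e + tau - d = e - d + tau by ring,
    show e - a + tau - d = e - a - d + tau by ring] at e2
  have := congrArg₂ (· - ·) e1 e2
  simp only [sub_zero] at this
  rw [← this]
  simp only [logBrace]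
  abel

/-! ### The elements `{z; 2p}` as an additive function of the logarithm. -/

theorem exists_ne_three (x y z : ℂ) : ∃ t : ℂ, t ≠ x ∧ t ≠ y ∧ t ≠ z := by
  obtain ⟨t, ht⟩ := (Set.toFinite {x, y, z}).exists_notMem
  simp only [mem_insert_iff, mem_singleton_iff, not_or] at ht
  exact ⟨t, ht⟩

theorem logBrace_add_tau_right {u v : ℂ} (h : exp u + exp v = 1) :
    logBrace u (v + tau) = logBrace u v := by
  obtain ⟨t, ht0, ht1, htu⟩ := exists_ne_three 0 1 (exp (-u))
  have hu : exp u ≠ 0 := exp_ne_zero u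
  have h1t : 1 - t ≠ 0 := sub_ne_zero.2 ht1.symm
  have hut : 1 - exp u * t ≠ 0 := by
    intro h0
    refine htu ?_
    rw [exp_neg]
    exact eq_inv_of_mul_eq_one_left (by linear_combination -h0)
  have hv : exp v = 1 - exp u := by rw [← h]; ring
  set d := log t
  set c := log (1 - t)
  set a := log (1 - exp u * t)
  have hd : exp d = t := exp_log ht0
  have hc : exp c = 1 - t := exp_log h1t
  have ha : exp a = 1 - exp u * t := exp_log hut
  have h1 : exp a + exp (u + d) = 1 := by rw [exp_add, hd, ha]; ring
  have h2 : exp c + exp d = 1 := by rw [hd, hc]; ring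
  have h3 : exp (v + d) = exp a - exp c := by rw [exp_add, hd, ha, hc, hv]; ring
  have e1 := logBrace_relation h1 h2 h3
  -- Shifting `a`, `c`, `e` together fixes `c - a`, `e - a` and `e - a - d`; only `e - d` moves,
  -- from `v` to `v + tau`.
  have e2 := logBrace_relation (a := a + tau) (b := u + d) (c := c + tau) (d := d) (e := v + d + tau)
    (by rwa [exp_add_tau]) (by rwa [exp_add_tau]) (by rwa [exp_add_tau, exp_add_tau, exp_add_tau])
  rw [show c + tau - (a + tau) = c - a by ring, show v + d + tau - (a + tau) = v + d - a by ring,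
    show v + d + tau - d = v + tau by ring] at e2
  rw [show v + d - d = v by ring] at e1
  rw [add_sub_cancel_right] at e1 e2
  exact add_left_cancel (e2.trans e1.symm)

theorem logBrace_add_int_mul_tau {u v : ℂ} (h : exp u + exp v = 1) (n : ℤ) :
    logBrace u (v + n * tau) = logBrace u v := by
  induction n with
  | zero => simp
  | succ n ih =>
    rw [← ih, ← logBrace_add_tau_right (v := v + ((n : ℤ) : ℂ) * tau)
      (by rwa [exp_add_int_mul_tau])]
    congr 1
    push_cast
    ring
  | pred n ih =>
    rw [← ih, ← logBrace_add_tau_right (v := v + ((-n - 1 : ℤ) : ℂ) * tau)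
      (by rwa [exp_add_int_mul_tau])]
    congr 1
    push_cast
    ring

/-- The common value of `logBrace u v` for all `v` with `e ^ u + e ^ v = 1`. -/
def chi (u : ℂ) : PreBloch := logBrace u (log (1 - exp u))

theorem logBrace_eq_chi {u v : ℂ} (h : exp u + exp v = 1) : logBrace u v = chi u := by
  have hv : exp v = 1 - exp u := by rw [← h]; ring
  have hne : 1 - exp u ≠ 0 := by rw [← hv]; exact exp_ne_zero v
  have hl : exp (log (1 - exp u)) = 1 - exp u := exp_log hne
  obtain ⟨n, hn⟩ := exp_eq_exp_iff_tau.1 (hv.trans hl.symm)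
  rw [hn, chi, logBrace_add_int_mul_tau (by rw [hl]; ring)]

theorem chi_add {u v : ℂ} (hu : exp u ≠ 1) (hv : exp v ≠ 1) (huv : exp (u + v) ≠ 1) :
    chi (u + v) = chi u + chi v := by
  rw [exp_add] at huv
  set z := exp u
  set w := exp v
  have hz1 : z - 1 ≠ 0 := sub_ne_zero.2 hu
  have hw1 : w - 1 ≠ 0 := sub_ne_zero.2 hv
  have hzw : z * w - 1 ≠ 0 := sub_ne_zero.2 huv
  -- These are `x` and, in the next line, `1 - y` for the solution of `y / x = z`, `(1 - x) / (1 -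
  -- y) = w`. The three term relation then involves exactly `u`, `u + v` and `v`.
  have hx : (w - 1) / (z * w - 1) ≠ 0 := div_ne_zero hw1 hzw
  have hy : (z - 1) / (z * w - 1) ≠ 0 := div_ne_zero hz1 hzw
  set a := log ((w - 1) / (z * w - 1))
  set d := log ((z - 1) / (z * w - 1))
  have ha : exp a = (w - 1) / (z * w - 1) := exp_log hx
  have hd : exp d = (z - 1) / (z * w - 1) := exp_log hy
  have hxy : (w - 1) / (z * w - 1) * (1 - z) ≠ 0 :=
    mul_ne_zero hx fun h => hz1 (by linear_combination -h)
  set e := log ((w - 1) / (z * w - 1) * (1 - z))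
  have he : exp e = (w - 1) / (z * w - 1) * (1 - z) := exp_log hxy
  have h1 : exp a + exp (v + d) = 1 := by
    rw [exp_add, ha, hd]
    change _ + w * _ = _
    rw [← mul_div_assoc, ← add_div, div_eq_one_iff_eq hzw]
    ring
  have h2 : exp (a + u) + exp d = 1 := by
    rw [exp_add, ha, hd]
    change _ * z + _ = _
    rw [div_mul_eq_mul_div, ← add_div, div_eq_one_iff_eq hzw]
    ring
  have h3 : exp e = exp a - exp (a + u) := by
    rw [exp_add, ha, he]
    change _ = _ - _ * z
    ring
  have hg : (![a, v + d, a + u, d, e] : Fin 5 → ℂ) ∈ fiveLogs := mem_fiveLogs.2 ⟨h1, h2, h3⟩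
  have hE2 := exp_fiveCoords hg 2
  have hE3 := exp_fiveCoords hg 3
  have hE4 := exp_fiveCoords hg 4
  simp only [fiveCoords, Matrix.cons_val] at hE2 hE3 hE4
  have := logBrace_relation h1 h2 h3
  rw [logBrace_eq_chi hE2, logBrace_eq_chi hE3, logBrace_eq_chi hE4, add_sub_cancel_left,
    add_sub_cancel_right, sub_add_eq_add_sub, sub_eq_zero] at this
  exact this.symm

/-- By additivity `chi u' - chi u` and `chi (u' - tau) - chi (u - tau)` both equal `chi (u' - u)`.
This needs `e ^ u ≠ e ^ u'`; otherwise a third point serves as intermediary. -/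
theorem chi_sub_chi_sub_tau {u u' : ℂ} (hu : exp u ≠ 1) (hu' : exp u' ≠ 1) :
    chi u - chi (u - tau) = chi u' - chi (u' - tau) := by
  have key : ∀ u u' : ℂ, exp u ≠ 1 → exp u' ≠ 1 → exp u ≠ exp u' →
      chi u - chi (u - tau) = chi u' - chi (u' - tau) := by
    intro u u' hu hu' hne
    have hd : exp (u' - u) ≠ 1 := by
      rw [exp_sub, ne_eq, div_eq_one_iff_eq (exp_ne_zero u)]
      exact hne.symm
    have e1 := chi_add hu hd (by rwa [add_sub_cancel])
    have e2 := chi_add (u := u - tau) (by rwa [exp_sub_tau]) hd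
      (by rwa [show u - tau + (u' - u) = u' - tau by ring, exp_sub_tau])
    rw [add_sub_cancel] at e1
    rw [show u - tau + (u' - u) = u' - tau by ring] at e2
    rw [e1, e2]
    abel
  obtain ⟨t, ht0, ht1, htu⟩ := exists_ne_three 0 1 (exp u)
  by_cases h : exp u = exp u'
  · have ht : exp (log t) = t := exp_log ht0
    rw [key u (log t) hu (by rwa [ht]) (by rw [ht]; exact htu.symm),
      key (log t) u' (by rwa [ht]) hu' (by rw [ht, ← h]; exact htu)]
  · exact key u u' hu hu' h

/-- The element `κ̂` of the extended pre-Bloch group. -/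
def kappa : PreBloch := chi (log 2) - chi (log 2 - tau)

theorem chi_sub_eq_kappa {u : ℂ} (hu : exp u ≠ 1) : chi u - chi (u - tau) = kappa :=
  chi_sub_chi_sub_tau hu (by rw [exp_log two_ne_zero]; norm_num)

/-- Replacing `b` by `b + tau` in `hstep` leaves the terms in `log 3` alone. Subtracting, the terms
in `log 2` give `chi (log 2) - chi (log 2 - tau)` and the last ones give `chi (b + tau - d) - chi (b
- d)`, with `d = log (-2)`. Both are `κ̂`. -/
theorem two_nsmul_kappa : 2 • kappa = 0 := by
  -- the relations for `x = 2`, `y = 3`, with `log x`, `log y`, `log (x - y)` shifted by a period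
  have hstep : ∀ b : ℂ, exp b = -1 →
      logSym (log 2) b - logSym (log 2 - tau) b
        - (logSym (log 3) (log (-2)) - logSym (log 3 - tau) (log (-2))) - chi (b - log (-2)) = 0 := by
    intro b hb
    have e2 : exp (log 2) = 2 := exp_log two_ne_zero
    have e3 : exp (log 3) = 3 := exp_log three_ne_zero
    have en2 : exp (log (-2)) = -2 := exp_log (by norm_num)
    have en1 : exp (log (-1)) = -1 := exp_log (by norm_num)
    have h1 : exp (log 2) + exp b = 1 := by rw [e2, hb]; norm_num
    have h2 : exp (log 3) + exp (log (-2)) = 1 := by rw [e3, en2]; norm_num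
    have h3 : exp (log (-1)) = exp (log 2) - exp (log 3) := by rw [en1, e2, e3]; norm_num
    have r1 := five_term h1 h2 h3
    have r2 := five_term (a := log 2 - tau) (b := b) (c := log 3 - tau) (d := log (-2))
      (e := log (-1) - tau)
      (by rwa [exp_sub_tau]) (by rwa [exp_sub_tau])
      (by rwa [exp_sub_tau, exp_sub_tau, exp_sub_tau])
    have hE : exp (b - log (-2)) + exp (log (-1) - tau - log (-2)) = 1 := by
      rw [exp_sub, exp_sub, exp_sub_tau, hb, en1, en2]; norm_num
    have h4 := logBrace_eq_chi hE
    rw [logBrace, show log (-1) - tau - log (-2) + tau = log (-1) - log (-2) by ring] at h4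
    rw [show log 3 - tau - (log 2 - tau) = log 3 - log 2 by ring,
      show log (-1) - tau - (log 2 - tau) = log (-1) - log 2 by ring] at r2
    have := congrArg₂ (· - ·) r1 r2
    simp only [sub_zero] at this
    rw [← this, ← h4]
    abel
  have hb : exp (log (-1)) = -1 := exp_log (by norm_num)
  have e2 : exp (log 2) = 2 := exp_log two_ne_zero
  have en2 : exp (log (-2)) = -2 := exp_log (by norm_num)
  have s1 := hstep _ hb
  have s2 := hstep (log (-1) + tau) (by rwa [exp_add_tau])
  have k1 : chi (log 2) - chi (log 2 - tau) = kappa := rfl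
  have k2 := chi_sub_eq_kappa (u := log (-1) + tau - log (-2)) (by
    rw [exp_sub, exp_add_tau, hb, en2]; norm_num)
  rw [show log (-1) + tau - log (-2) - tau = log (-1) - log (-2) by ring] at k2
  have c1 := logBrace_eq_chi (u := log 2) (v := log (-1)) (by rw [e2, hb]; norm_num)
  have c2 := logBrace_eq_chi (u := log 2 - tau) (v := log (-1))
    (by rw [exp_sub_tau, e2, hb]; norm_num)
  rw [logBrace] at c1 c2
  have := congrArg₂ (· - ·) s1 s2
  simp only [sub_zero] at this
  rw [two_nsmul, ← this]
  nth_rewrite 1 [← k1]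
  rw [← k2, ← c1, ← c2]
  abel

/-! ### Return to the original symbols, and the value of the dilogarithm on `κ̂`. -/

theorem exp_coord_add (z : CutPlane) (p q : ℤ) :
    exp (z.log + p * tau) + exp (z.logOneSub - q * tau) = 1 := by
  have h1 := z.exp_coord_fst p q
  have h2 := z.exp_coord_snd p q
  simp only [CutPlane.coord] at h1 h2
  rw [h1, h2]
  ring

theorem brace_eq_chi (z : CutPlane) (p q : ℤ) : brace z p q = chi (z.log + p * tau) := by
  rw [brace_eq_logBrace, logBrace_eq_chi (exp_coord_add z p q)]

theorem brace_sub_brace (z : CutPlane) (p q q' : ℤ) :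
    brace z p q - brace z (p - 1) q' = kappa := by
  rw [brace_eq_chi, brace_eq_chi, ← chi_sub_eq_kappa (u := z.log + p * tau)]
  · congr 2
    push_cast
    ring
  · intro h
    exact exp_ne_zero (z.logOneSub - (0 : ℤ) * tau) (by linear_combination exp_coord_add z p 0 - h)

/-- The homomorphism induced by the extended Rogers dilogarithm on the extended pre-Bloch group. -/
def rogersHom : PreBloch →+ ℂ ⧸ Z2 :=
  QuotientAddGroup.lift rhohat.range (FreeAbelianGroup.lift Chat.lhat) (by
    rintro _ ⟨a, rfl⟩
    have : (FreeAbelianGroup.lift Chat.lhat).comp rhohat = 0 := by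
      ext ⟨w, hw⟩
      rw [FThat_eq_image] at hw
      obtain ⟨g, hg, rfl⟩ := hw
      simp only [AddMonoidHom.comp_apply, AddMonoidHom.zero_apply, rhohat_of, altSum, map_add,
        map_sub, FreeAbelianGroup.lift_apply_of]
      exact fiveSum_eq_zero hg
    exact DFunLike.congr_fun this a)

theorem rogersHom_sym (z : CutPlane) (p q : ℤ) :
    rogersHom (sym z p q) = ((rogers z p q : ℂ) : ℂ ⧸ Z2) := by
  rw [sym, rogersHom]
  erw [QuotientAddGroup.lift_mk]
  rw [FreeAbelianGroup.lift_apply_of, Chat.lhat_mk]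

/-- `κ̂` is a mixed second difference in `p` and `q`, so only the bilinear term contributes, with
`(2πi)² / 2`. -/
theorem rogersHom_kappa :
    rogersHom kappa = ((-2 * (Real.pi : ℂ) ^ 2 : ℂ) : ℂ ⧸ Z2) := by
  rw [← brace_sub_brace (.above (-1) (Or.inl (by norm_num))) 0 0 0, brace, brace]
  simp only [map_sub, rogersHom_sym, ← QuotientAddGroup.mk_sub]
  congr 1
  simp only [rogers]
  push_cast
  linear_combination (2 * (Real.pi : ℂ) ^ 2) * I_sq

theorem neg_two_mul_pi_sq_ne_zero : ((-2 * (Real.pi : ℂ) ^ 2 : ℂ) : ℂ ⧸ Z2) ≠ 0 := by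
  rw [ne_eq, QuotientAddGroup.eq_zero_iff, Z2, AddSubgroup.mem_zmultiples_iff]
  rintro ⟨n, hn⟩
  have hpi : (Real.pi : ℂ) ≠ 0 := ofReal_ne_zero.2 Real.pi_ne_zero
  rw [mul_pow, I_sq, zsmul_eq_mul] at hn
  have h : (2 * n : ℂ) = 1 := by
    have : (Real.pi : ℂ) ^ 2 * (2 * n) = (Real.pi : ℂ) ^ 2 * 1 := by linear_combination -hn / 2
    exact mul_left_cancel₀ (pow_ne_zero 2 hpi) this
  have h2 : 2 * n = 1 := by exact_mod_cast h
  omega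

theorem addOrderOf_kappa : addOrderOf kappa = 2 :=
  addOrderOf_eq_prime two_nsmul_kappa fun h => neg_two_mul_pi_sq_ne_zero (by
    rw [← rogersHom_kappa, h, map_zero])

end ExtBloch
end

theorem lemma3p2 :
    (∀ (z : ExtBloch.CutPlane) (p q q' : ℤ), ExtBloch.brace z p q = ExtBloch.brace z p q') ∧
    ∃ κ : ExtBloch.PreBloch,
      (∀ (z : ExtBloch.CutPlane) (p q q' : ℤ),
        ExtBloch.brace z p q - ExtBloch.brace z (p - 1) q' = κ) ∧
      addOrderOf κ = 2 ∧
      (∃ L : ExtBloch.PreBloch →+ ℂ ⧸ ExtBloch.Z2,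
        (∀ (z : ExtBloch.CutPlane) (p q : ℤ),
          L (ExtBloch.sym z p q) = ((ExtBloch.rogers z p q : ℂ) : ℂ ⧸ ExtBloch.Z2)) ∧
        L κ = ((-2 * (Real.pi : ℂ) ^ 2 : ℂ) : ℂ ⧸ ExtBloch.Z2)) ∧
      ((-2 * (Real.pi : ℂ) ^ 2 : ℂ) : ℂ ⧸ ExtBloch.Z2) ≠ 0 :=
  ⟨fun z p q q' => by rw [ExtBloch.brace_eq_chi, ExtBloch.brace_eq_chi],
    ExtBloch.kappa, ExtBloch.brace_sub_brace, ExtBloch.addOrderOf_kappa,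
    ⟨ExtBloch.rogersHom, ExtBloch.rogersHom_sym, ExtBloch.rogersHom_kappa⟩,
    ExtBloch.neg_two_mul_pi_sq_ne_zero⟩
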